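/- Let $n_z,n_y\ge 1$, $n_w,n_q,n_s,n_p\ge 0$ and let $A\in\mathbb R^{n_z\times n_z}$, $B\in\mathbb R^{n_z\times n_s}$, $C\in\mathbb R^{n_y\times n_z}$, $N\in\mathbb R^{n_z\times n_w}$, $S\in\mathbb R^{n_q\times n_z}$, $C_p\in\mathbb R^{n_p\times n_z}$. Let $\psi:\mathbb R^{n_q}\to\mathbb R^{n_s}$ satisfy $|\psi(v_1)-\psi(v_2)|\le\ell|v_1-v_2|$ for all $v_1,v_2$, with $\ell>0$, and let $0<T_1\le T_2$. For gains $L\in\mathbb R^{n_z\times n_y}$, $H\in\mathbb R^{n_y\times n_y}$ let $\mathcal H_e$ be the hybrid system with state $x=(z,\varepsilon,\tilde\theta,\tau)\in\mathbb R^{2n_z+n_y+1}$, input $u=(w,\eta)\in\mathbb R^{n_w+n_y}$ and output $y_p=C_p\varepsilon$ which flows, when $\tau\in[0,T_2]$, according to $$\dot z=Az+B\psi(Sz)+Nw,\qquad \begin{pmatrix}\dot\varepsilon\\ \dot{\tilde\theta}\end{pmatrix}=\begin{pmatrix}A-LC&L\\ CA-CLC-HC&CL+H\end{pmatrix}\begin{pmatrix}\varepsilon\\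 \tilde\theta\end{pmatrix}+\begin{pmatrix}B\\ CB\end{pmatrix}\bigl(\psi(Sz)-\psi(S(z-\varepsilon))\bigr)+\begin{pmatrix}N\\ CN\end{pmatrix}w,\qquad \dot\tau=-1,$$ and jumps, when $\tau=0$, according to $z^+=z$, $\varepsilon^+=\varepsilon$, $\tilde\theta^+=-\eta$, $\tau^+\in[T_1,T_2]$. Solution pairs $(\phi,u)$ are taken in the usual sense on hybrid time domains: $\phi(\cdot,j)$ is locally absolutely continuous, and $u(\cdot,j)$ is measurable and essentially bounded on bounded time intervals. Let $\mathcal A=\mathbb R^{n_z}\times\{0\}\times\{0\}\times[0,T_2]$, let $|x|_{\mathcal A}$ be the Euclidean distance of $x$ to $\mathcal A$, and let $\|u\|_\infty$ be the $\mathcal L_\infty$ norm of a hybrid signal (the larger of the essential supremum of $|u|$ along flows and the supremum of $|u|$ at the jump points). For symmetric positive definite $P_1\in\mathbb R^{n_z\times n_z}$, $P_2\in\mathbb R^{n_y\times n_y}$, real numbers $\delta,\chi,\gamma>0$ and $\tau\in[0,T_2]$ let $\mathcal M_0(\tau)$ be the symmetric matrix (with $\operatorname{He}(X)=X+X^{\mathsf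 T}$ and $\bullet$ standing for the symmetric blocks) $$\mathcal M_0(\tau)=\begin{pmatrix} \operatorname{He}(P_1(A-LC))+C_p^{\mathsf T}C_p+\chi\ell^2S^{\mathsf T}S & P_1L+e^{\delta\tau}(CA-CLC-HC)^{\mathsf T}P_2 & P_1N & P_1B\\ \bullet & e^{\delta\tau}\bigl(\operatorname{He}(P_2(CL+H))-\delta P_2\bigr) & e^{\delta\tau}P_2CN & e^{\delta\tau}P_2CB\\ \bullet&\bullet&-\gamma^2 I_{n_w}&0\\ \bullet&\bullet&\bullet&-\chi I_{n_s}\end{pmatrix}.$$ Let $\gamma>0$ be given, and suppose that there are symmetric positive definite $P_1,P_2$, real numbers $\delta,\chi>0$ and matrices $L,H$ such that $\mathcal M_0(0)<0$ and $\mathcal M_0(T_2)<0$. Put $$\beta=-\max_{\tau\in[0,T_2]}\lambda_{\max}(\mathcal M_0(\tau)),\qquad \rho_2=\max\{\lambda_{\max}(P_1),\lambda_{\max}(P_2)e^{\delta T_2}\}.$$ Then the maximum is attained, $\beta>0$, and for the system $\mathcal H_e$ with these gains $L,H$: 1. $\mathcal H_e$ is exponentially input-to-state stable (eISS) with respect to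 $\mathcal A$: every maximal solution pair is complete, and there are $\kappa,\lambda>0$ and a class-$\mathcal K$ function $\rho$ such that every solution pair $(\phi,u)$ with $\|u\|_\infty<\infty$ satisfies $|\phi(t,j)|_{\mathcal A}\le\max\{\kappa e^{-\lambda(t+j)}|\phi(0,0)|_{\mathcal A},\rho(\|u\|_\infty)\}$ for all $(t,j)\in\operatorname{dom}\phi$. 2. The decay rate with respect to the flow time is $\beta/(2\rho_2)$: there are $\kappa>0$ and a class-$\mathcal K$ function $\rho$ such that every solution pair $(\phi,u)$ with $\|u\|_\infty<\infty$ satisfies $|\phi(t,j)|_{\mathcal A}\le\max\{\kappa e^{-\frac{\beta}{2\rho_2}t}|\phi(0,0)|_{\mathcal A},\rho(\|u\|_\infty)\}$ for all $(t,j)\in\operatorname{dom}\phi$. 3. There is $\alpha>0$ such that every solution pair $(\phi,u)$, $u=(w,\eta)$, with $\eta\equiv0$ satisfies $$\sqrt{\int_{\mathcal I}|y_p(s,j(s))|^2ds}\le\alpha|\phi(0,0)|_{\mathcal A}+\gamma\sqrt{\int_{\mathcal I}|w(s,j(s))|^2ds},$$ where $\mathcal I=\{t:\exists j,\ (t,j)\in\operatorname{dom}\phi\}$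 and $j(s)=\min\{j:(s,j)\in\operatorname{dom}\phi\}$; the integrals take values in $[0,\infty]$. -/

import Mathlib

open Set MeasureTheory Matrix
open scoped ENNReal

noncomputable section

/-! ### Hybrid time domains and hybrid signals -/

/-- `E ⊆ ℝ≥0 × ℕ` is a hybrid time domain: a union of a finite or infinite sequence of intervals
`[t_j, t_{j+1}] × {j}`, the last interval (if it exists) being allowed to be of the form
`[t_J, T)` with `T` finite or infinite. -/
def IsHybridTimeDomain (E : Set (ℝ × ℕ)) : Prop :=
  ∃ t : ℕ → ℝ, t 0 = 0 ∧ Monotone t ∧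
    ((E = {p | p.1 ∈ Icc (t p.2) (t (p.2 + 1))}) ∨
      ∃ (J : ℕ) (I : Set ℝ),
        ((∃ T, t J ≤ T ∧ I = Icc (t J) T) ∨ (∃ T, t J < T ∧ I = Ico (t J) T) ∨ I = Ici (t J)) ∧
        E = {p | (p.2 < J ∧ p.1 ∈ Icc (t p.2) (t (p.2 + 1))) ∨ (p.2 = J ∧ p.1 ∈ I)})

/-- The time slice `{t | (t, j) ∈ E}`. -/
def hybridSlice (E : Set (ℝ × ℕ)) (j : ℕ) : Set ℝ := {t | (t, j) ∈ E}

/-- `dom_t`: the projection of the domain on the ordinary-time axis. -/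
def domTime (E : Set (ℝ × ℕ)) : Set ℝ := {t | ∃ j, (t, j) ∈ E}

/-- `j(t) = min {j | (t, j) ∈ E}`. -/
def minJump (E : Set (ℝ × ℕ)) (t : ℝ) : ℕ := sInf {j | (t, j) ∈ E}

/-- `Γ`: the points `(t, j)` of the domain such that `(t, j + 1)` is in the domain. -/
def jumpTimes (E : Set (ℝ × ℕ)) : Set (ℝ × ℕ) := {p | p ∈ E ∧ (p.1, p.2 + 1) ∈ E}

/-- A signal `φ` over the hybrid time domain `E` is a hybrid arc: `φ(·, j)` is locally absolutely
continuous for each `j`. (Signals are total functions; only the values on `E` are ever used.) -/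
def IsHybridArc {X : Type*} [NormedAddCommGroup X] (E : Set (ℝ × ℕ)) (φ : ℝ → ℕ → X) : Prop :=
  ∀ (j : ℕ) (a b : ℝ), a ≤ b → Icc a b ⊆ hybridSlice E j →
    AbsolutelyContinuousOnInterval (fun t => φ t j) a b

/-- A signal `u` over the hybrid time domain `E` is a hybrid input: for each `j`, `u(·, j)` is
Lebesgue measurable and locally essentially bounded, i.e. essentially bounded on every bounded
part of its interval of definition. -/
def IsHybridInput {U : Type*} [NormedAddCommGroup U] (E : Set (ℝ × ℕ)) (u : ℝ → ℕ → U) : Prop :=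
  ∀ j : ℕ, AEStronglyMeasurable (fun t => u t j) (volume.restrict (hybridSlice E j)) ∧
    ∀ T : ℝ, ∃ K : ℝ, ∀ᵐ t ∂(volume.restrict (hybridSlice E j ∩ Iic T)), ‖u t j‖ ≤ K

/-- The `T`-truncated `L_∞` norm of a hybrid signal: the maximum of the essential supremum over
`E \ Γ` and of the supremum over `Γ`, both restricted to `t + j ≤ T`. -/
def truncLinfNorm {U : Type*} [NormedAddCommGroup U] (E : Set (ℝ × ℕ)) (u : ℝ → ℕ → U) (T : ℝ) :
    ℝ≥0∞ :=
  max
    (⨆ k : ℕ, essSup (fun s => ‖u s k‖ₑ)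
      (volume.restrict {s : ℝ | (s, k) ∈ E \ jumpTimes E ∧ s + k ≤ T}))
    (⨆ p ∈ {p : ℝ × ℕ | p ∈ jumpTimes E ∧ p.1 + p.2 ≤ T}, ‖u p.1 p.2‖ₑ)

/-- The `L_∞` norm of a hybrid signal. The truncated norm is nondecreasing in `T`, so that its
limit is its supremum. -/
def linfNorm {U : Type*} [NormedAddCommGroup U] (E : Set (ℝ × ℕ)) (u : ℝ → ℕ → U) : ℝ≥0∞ :=
  ⨆ T : ℝ, truncLinfNorm E u T

/-! ### Hybrid systems with inputs and outputs -/

/-- The data `(C, f, D, G, h)` of a hybrid system with state space `X`, input space `U` and output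
space `Y`. -/
structure HybridSystem (X U Y : Type*) where
  flowSet : Set X
  flowMap : X → U → X
  jumpSet : Set X
  jumpMap : X → U → Set X
  output : X → Y

/-- `(φ, u)`, with common domain `E`, is a solution pair to `H`. -/
structure IsSolutionPair {X U Y : Type*} [NormedAddCommGroup X] [NormedSpace ℝ X]
    [NormedAddCommGroup U] (H : HybridSystem X U Y)
    (E : Set (ℝ × ℕ)) (φ : ℝ → ℕ → X) (u : ℝ → ℕ → U) : Prop where
  domain : IsHybridTimeDomain E
  arc : IsHybridArc E φ
  input : IsHybridInput E u
  initial : φ 0 0 ∈ H.flowSet ∪ H.jumpSet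
  flow : ∀ j : ℕ, ∀ᵐ t : ℝ, (t, j) ∈ E →
    φ t j ∈ H.flowSet ∧
      HasDerivWithinAt (fun s => φ s j) (H.flowMap (φ t j) (u t j)) (hybridSlice E j) t
  jump : ∀ (t : ℝ) (j : ℕ), (t, j) ∈ E → (t, j + 1) ∈ E →
    φ t j ∈ H.jumpSet ∧ φ t (j + 1) ∈ H.jumpMap (φ t j) (u t j)

/-- A solution pair is maximal if it cannot be extended. -/
def IsMaximalSolutionPair {X U Y : Type*} [NormedAddCommGroup X] [NormedSpace ℝ X]
    [NormedAddCommGroup U] (H : HybridSystem X U Y)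
    (E : Set (ℝ × ℕ)) (φ : ℝ → ℕ → X) (u : ℝ → ℕ → U) : Prop :=
  IsSolutionPair H E φ u ∧
    ∀ (E' : Set (ℝ × ℕ)) (φ' : ℝ → ℕ → X) (u' : ℝ → ℕ → U),
      IsSolutionPair H E' φ' u' → E ⊆ E' →
      (∀ p ∈ E, φ' p.1 p.2 = φ p.1 p.2 ∧ u' p.1 p.2 = u p.1 p.2) → E' = E

/-- Class `K` functions on `[0, ∞)`. -/
def IsClassK (ρ : ℝ → ℝ) : Prop :=
  ContinuousOn ρ (Ici 0) ∧ StrictMonoOn ρ (Ici 0) ∧ ρ 0 = 0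

/-- Pre-exponential input-to-state stability with respect to `𝒜`. -/
def IsPreEISS {X U Y : Type*} [NormedAddCommGroup X] [NormedSpace ℝ X]
    [NormedAddCommGroup U] (H : HybridSystem X U Y) (𝒜 : Set X) : Prop :=
  ∃ (κ lam : ℝ) (ρ : ℝ → ℝ), 0 < κ ∧ 0 < lam ∧ IsClassK ρ ∧
    ∀ (E : Set (ℝ × ℕ)) (φ : ℝ → ℕ → X) (u : ℝ → ℕ → U),
      IsSolutionPair H E φ u → linfNorm E u < ∞ →
      ∀ (t : ℝ) (j : ℕ), (t, j) ∈ E →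
        Metric.infDist (φ t j) 𝒜 ≤
          max (κ * Real.exp (-lam * (t + j)) * Metric.infDist (φ 0 0) 𝒜)
            (ρ (linfNorm E u).toReal)

/-- Exponential input-to-state stability with respect to `𝒜`: pre-exponential input-to-state
stability, and every maximal solution pair is complete (has an unbounded domain). -/
def IsEISS {X U Y : Type*} [NormedAddCommGroup X] [NormedSpace ℝ X]
    [NormedAddCommGroup U] (H : HybridSystem X U Y) (𝒜 : Set X) : Prop :=
  IsPreEISS H 𝒜 ∧
    ∀ (E : Set (ℝ × ℕ)) (φ : ℝ → ℕ → X) (u : ℝ → ℕ → U),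
      IsMaximalSolutionPair H E φ u → ¬ Bornology.IsBounded E

/-- The input-to-state estimate holds with exponential decay rate `r` with respect to the flow
time `t`. -/
def HasFlowTimeDecayRate {X U Y : Type*} [NormedAddCommGroup X] [NormedSpace ℝ X]
    [NormedAddCommGroup U] (H : HybridSystem X U Y) (𝒜 : Set X) (r : ℝ) : Prop :=
  ∃ (κ : ℝ) (ρ : ℝ → ℝ), 0 < κ ∧ IsClassK ρ ∧
    ∀ (E : Set (ℝ × ℕ)) (φ : ℝ → ℕ → X) (u : ℝ → ℕ → U),
      IsSolutionPair H E φ u → linfNorm E u < ∞ →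
      ∀ (t : ℝ) (j : ℕ), (t, j) ∈ E →
        Metric.infDist (φ t j) 𝒜 ≤
          max (κ * Real.exp (-r * t) * Metric.infDist (φ 0 0) 𝒜)
            (ρ (linfNorm E u).toReal)

/-! ### The plant, the observer and the hybrid error system -/

/-- The data of the plant `ż = A z + B ψ(S z) + N w`, `y = C z + η`, of the performance output
`y_p = C_p (z - ẑ)`, of the Lipschitz constant `ℓ` of `ψ` and of the bounds `T₁ ≤ T₂` on the time
between measurements. -/
structure SampledPlant (nz ny nw nq ns np : ℕ) where
  A : Matrix (Fin nz) (Fin nz) ℝ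
  B : Matrix (Fin nz) (Fin ns) ℝ
  C : Matrix (Fin ny) (Fin nz) ℝ
  N : Matrix (Fin nz) (Fin nw) ℝ
  S : Matrix (Fin nq) (Fin nz) ℝ
  Cp : Matrix (Fin np) (Fin nz) ℝ
  ψ : EuclideanSpace ℝ (Fin nq) → EuclideanSpace ℝ (Fin ns)
  ell : ℝ
  T₁ : ℝ
  T₂ : ℝ

/-- The state space `ℝ^{2 n_z + n_y + 1}` of the error system, with its Euclidean norm; its points
are `x = (z, (ε, θ̃), τ)`. -/
abbrev ErrState (nz ny : ℕ) : Type :=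
  EuclideanSpace ℝ (Fin nz ⊕ ((Fin nz ⊕ Fin ny) ⊕ Unit))

/-- The input space `ℝ^{n_w + n_y}`, with its Euclidean norm; its points are `u = (w, η)`. -/
abbrev ErrInput (nw ny : ℕ) : Type := EuclideanSpace ℝ (Fin nw ⊕ Fin ny)

namespace ErrState

variable {nz ny : ℕ}

/-- Assemble a state from its components. -/
def mk (z : Fin nz → ℝ) (e : Fin nz ⊕ Fin ny → ℝ) (τ : ℝ) : ErrState nz ny :=
  WithLp.toLp 2 (Sum.elim z (Sum.elim e fun _ => τ))

def z (x : ErrState nz ny) : Fin nz → ℝ := fun i => x (Sum.inl i)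

/-- The pair `(ε, θ̃)`. -/
def err (x : ErrState nz ny) : Fin nz ⊕ Fin ny → ℝ := fun i => x (Sum.inr (Sum.inl i))

def ε (x : ErrState nz ny) : Fin nz → ℝ := fun i => x.err (Sum.inl i)

def θ (x : ErrState nz ny) : Fin ny → ℝ := fun i => x.err (Sum.inr i)

def τ (x : ErrState nz ny) : ℝ := x (Sum.inr (Sum.inr ()))

end ErrState

namespace ErrInput

variable {nw ny : ℕ}

def w (u : ErrInput nw ny) : Fin nw → ℝ := fun i => u (Sum.inl i)

def η (u : ErrInput nw ny) : Fin ny → ℝ := fun i => u (Sum.inr i)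

end ErrInput

namespace SampledPlant

variable {nz ny nw nq ns np : ℕ}

/-- `ψ` on coordinate vectors. -/
def psi (p : SampledPlant nz ny nw nq ns np) (v : Fin nq → ℝ) : Fin ns → ℝ :=
  WithLp.ofLp (p.ψ (WithLp.toLp 2 v))

/-- `ζ(v₁, v₂) = ψ(S v₁) - ψ(S (v₁ - v₂))`. -/
def zeta (p : SampledPlant nz ny nw nq ns np) (v₁ v₂ : Fin nz → ℝ) : Fin ns → ℝ :=
  p.psi (p.S *ᵥ v₁) - p.psi (p.S *ᵥ (v₁ - v₂))

def matF (p : SampledPlant nz ny nw nq ns np)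
    (L : Matrix (Fin nz) (Fin ny) ℝ) (H : Matrix (Fin ny) (Fin ny) ℝ) :
    Matrix (Fin nz ⊕ Fin ny) (Fin nz ⊕ Fin ny) ℝ :=
  fromBlocks (p.A - L * p.C) L (p.C * p.A - p.C * L * p.C - H * p.C) (p.C * L + H)

def matT (p : SampledPlant nz ny nw nq ns np) : Matrix (Fin nz ⊕ Fin ny) (Fin nw) ℝ :=
  fromRows p.N (p.C * p.N)

def matQ (p : SampledPlant nz ny nw nq ns np) : Matrix (Fin nz ⊕ Fin ny) (Fin ns) ℝ :=
  fromRows p.B (p.C * p.B)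

/-- The hybrid system `H_e` with gains `L`, `H`. -/
def errorSystem (p : SampledPlant nz ny nw nq ns np)
    (L : Matrix (Fin nz) (Fin ny) ℝ) (H : Matrix (Fin ny) (Fin ny) ℝ) :
    HybridSystem (ErrState nz ny) (ErrInput nw ny) (EuclideanSpace ℝ (Fin np)) where
  flowSet := {x | x.τ ∈ Icc 0 p.T₂}
  flowMap x u := ErrState.mk
    (p.A *ᵥ x.z + p.B *ᵥ p.psi (p.S *ᵥ x.z) + p.N *ᵥ u.w)
    (p.matF L H *ᵥ x.err + p.matQ *ᵥ p.zeta x.z x.ε + p.matT *ᵥ u.w)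
    (-1)
  jumpSet := {x | x.τ = 0}
  jumpMap x u := {g | ∃ v ∈ Icc p.T₁ p.T₂, g = ErrState.mk x.z
    ((fromBlocks 1 0 0 0 : Matrix (Fin nz ⊕ Fin ny) (Fin nz ⊕ Fin ny) ℝ) *ᵥ x.err +
      (fromRows 0 (-1) : Matrix (Fin nz ⊕ Fin ny) (Fin ny) ℝ) *ᵥ u.η) v}
  output x := WithLp.toLp 2 (p.Cp *ᵥ x.ε)

/-- The set `𝒜 = ℝ^{n_z} × {0} × {0} × [0, T₂]`. -/
def attractor (p : SampledPlant nz ny nw nq ns np) : Set (ErrState nz ny) :=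
  {x | x.ε = 0 ∧ x.θ = 0 ∧ x.τ ∈ Icc 0 p.T₂}

/-- `L₂` external stability from `w` to `y_p` with gain `γ` when `η ≡ 0`. The integrals take
values in `[0, ∞]`. -/
def HasL2Gain (p : SampledPlant nz ny nw nq ns np)
    (L : Matrix (Fin nz) (Fin ny) ℝ) (H : Matrix (Fin ny) (Fin ny) ℝ) (γ : ℝ) : Prop :=
  ∃ α : ℝ, 0 < α ∧
    ∀ (E : Set (ℝ × ℕ)) (φ : ℝ → ℕ → ErrState nz ny) (u : ℝ → ℕ → ErrInput nw ny),
      IsSolutionPair (p.errorSystem L H) E φ u → (∀ q ∈ E, (u q.1 q.2).η = 0) →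
      (∫⁻ s in domTime E, ‖(p.errorSystem L H).output (φ s (minJump E s))‖ₑ ^ 2) ^ (1 / 2 : ℝ) ≤
        ENNReal.ofReal (α * Metric.infDist (φ 0 0) p.attractor) +
        ENNReal.ofReal γ *
          (∫⁻ s in domTime E,
            ‖(WithLp.toLp 2 (u s (minJump E s)).w : EuclideanSpace ℝ (Fin nw))‖ₑ ^ 2) ^ (1 / 2 : ℝ)

end SampledPlant

/-! ### The matrix inequality -/

/-- `He(X) = X + Xᵀ`. -/
def matHe {n : Type*} (X : Matrix n n ℝ) : Matrix n n ℝ := X + Xᵀ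

/-- The largest (real) eigenvalue of a symmetric matrix. -/
def lambdaMax {n : Type*} [Fintype n] [DecidableEq n] (X : Matrix n n ℝ) : ℝ :=
  sSup (spectrum ℝ X)

/-- The symmetric matrix `ℳ(τ)`, partitioned along `(ε, θ̃, w, ζ)`. -/
def SampledPlant.matM {nz ny nw nq ns np : ℕ} (p : SampledPlant nz ny nw nq ns np)
    (L : Matrix (Fin nz) (Fin ny) ℝ) (H : Matrix (Fin ny) (Fin ny) ℝ)
    (P₁ : Matrix (Fin nz) (Fin nz) ℝ) (P₂ : Matrix (Fin ny) (Fin ny) ℝ)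
    (δ χ γ lamt τ : ℝ) :
    Matrix ((Fin nz ⊕ Fin ny) ⊕ (Fin nw ⊕ Fin ns)) ((Fin nz ⊕ Fin ny) ⊕ (Fin nw ⊕ Fin ns)) ℝ :=
  let e : ℝ := Real.exp (δ * τ)
  let M₁₁ : Matrix (Fin nz) (Fin nz) ℝ :=
    matHe (P₁ * (p.A - L * p.C)) + (2 * lamt) • P₁ + p.Cpᵀ * p.Cp + (χ * p.ell ^ 2) • (p.Sᵀ * p.S)
  let M₁₂ : Matrix (Fin nz) (Fin ny) ℝ :=
    P₁ * L + e • ((p.C * p.A - p.C * L * p.C - H * p.C)ᵀ * P₂)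
  let M₂₂ : Matrix (Fin ny) (Fin ny) ℝ :=
    e • (matHe (P₂ * (p.C * L + H)) + (2 * lamt - δ) • P₂)
  let M₁' : Matrix (Fin nz ⊕ Fin ny) (Fin nw ⊕ Fin ns) ℝ :=
    fromBlocks (P₁ * p.N) (P₁ * p.B) (e • (P₂ * p.C * p.N)) (e • (P₂ * p.C * p.B))
  fromBlocks (fromBlocks M₁₁ M₁₂ M₁₂ᵀ M₂₂) M₁' M₁'ᵀ
    (fromBlocks (-(γ ^ 2) • 1) 0 0 (-χ • 1))

end

open scoped NNReal

/-! The Lyapunov function is V = εᵀP₁ε + e^{δτ} θ̃ᵀP₂θ̃ (`ErrState.energy`). As τ' = -1 along flows,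
the quadratic form of ℳ₀(τ) at (ε, θ̃, w, ζ), with ζ the increment of ψ, is V' + |y_p|² - γ²|w|² +
χ(ℓ²|Sε|² - |ζ|²) (`SampledPlant.matM_quadraticForm`). The Lipschitz bound makes the last term
nonnegative, so ℳ₀(τ) ≤ -β I yields V' ≤ -β|(ε, θ̃)|² - |y_p|² + γ²|w|². Conditions at the two
endpoints suffice because ℳ₀ is affine in e^{δτ}: on [0, T₂] it is a convex combination of its
endpoint values.

Since V ≤ ρ₂|(ε, θ̃)|², the energy decays along flows at rate c = β/ρ₂ up to an input term. A jump
replaces θ̃ by -η and adds at most a multiple of |η|². These increments do not accumulate, because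
at least T₁ units of flow separate consecutive jumps: `SampledPlant.exists_energy_le` carries a term
D‖u‖²e^{cτ}, which shrinks at rate c during flows and grows at each jump by enough to absorb the
increment. V is comparable to the squared distance to the attractor, which halves the rate. The
timer also gives j ≤ (t + T₂)/T₁, so decay in t implies decay in t + j.

For the gain, the same dissipation inequality is integrated over each slice. With η = 0 the energy
does not increase at jumps, so the slices telescope, and subadditivity of the square root finishes.

Completeness is separate. A maximal solution with bounded domain would end with a half-open or a
compact interval. In the first case linear growth of the flow map lets it be continued to the
endpoint. In the second it can jump if τ = 0, or flow on with zero input if τ > 0, by local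
existence. -/

theorem dotProduct_self_pos {n : Type*} [Fintype n] {v : n → ℝ} (hv : v ≠ 0) : 0 < v ⬝ᵥ v := by
  simpa using dotProduct_star_self_pos_iff.2 hv

theorem dotProduct_self_nonneg {n : Type*} [Fintype n] (v : n → ℝ) : 0 ≤ v ⬝ᵥ v := by
  simpa using dotProduct_star_self_nonneg v

theorem EuclideanSpace.norm_sq_eq_dotProduct {n : Type*} [Fintype n] (x : EuclideanSpace ℝ n) :
    ‖x‖ ^ 2 = x.ofLp ⬝ᵥ x.ofLp := by
  rw [EuclideanSpace.real_norm_sq_eq]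
  simp only [dotProduct, pow_two]

/-! ### Largest eigenvalue and quadratic forms. -/

section LambdaMax

variable {n : Type*} [Fintype n] [DecidableEq n]

theorem Matrix.IsHermitian.lambdaMax_mem_spectrum [Nonempty n] {X : Matrix n n ℝ}
    (hX : X.IsHermitian) : lambdaMax X ∈ spectrum ℝ X := by
  have h := hX.spectrum_real_eq_range_eigenvalues
  have hfin : (spectrum ℝ X).Finite := h ▸ finite_range _
  have hne : (spectrum ℝ X).Nonempty := h ▸ range_nonempty _
  exact hne.csSup_mem hfin

theorem Matrix.IsHermitian.exists_mulVec_eq_lambdaMax [Nonempty n] {X : Matrix n n ℝ}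
    (hX : X.IsHermitian) : ∃ v : n → ℝ, v ≠ 0 ∧ X *ᵥ v = lambdaMax X • v := by
  have h := hX.lambdaMax_mem_spectrum
  rw [spectrum.mem_iff, Matrix.isUnit_iff_isUnit_det, isUnit_iff_ne_zero, not_not] at h
  obtain ⟨v, hv, hv0⟩ := Matrix.exists_mulVec_eq_zero_iff.mpr h
  refine ⟨v, hv, ?_⟩
  rw [sub_mulVec, sub_eq_zero, Algebra.algebraMap_eq_smul_one, smul_mulVec, one_mulVec] at hv0
  exact hv0.symm

/-- Shifting by the supremum of the spectrum makes the spectrum of λI - X nonnegative, so this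
matrix is positive semidefinite. -/
theorem Matrix.IsHermitian.dotProduct_mulVec_le_lambdaMax {X : Matrix n n ℝ}
    (hX : X.IsHermitian) (v : n → ℝ) : v ⬝ᵥ X *ᵥ v ≤ lambdaMax X * (v ⬝ᵥ v) := by
  have hfin : (spectrum ℝ X).Finite := hX.spectrum_real_eq_range_eigenvalues ▸ finite_range _
  have hpos : (algebraMap ℝ (Matrix n n ℝ) (lambdaMax X) - X).PosSemidef := by
    rw [posSemidef_iff_isHermitian_and_spectrum_nonneg]
    refine ⟨?_, ?_⟩
    · refine IsHermitian.sub ?_ hX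
      rw [Algebra.algebraMap_eq_smul_one]
      simp [IsHermitian]
    · rw [← spectrum.singleton_sub_eq]
      rintro _ ⟨_, rfl, y, hy, rfl⟩
      exact sub_nonneg.2 (le_csSup hfin.bddAbove hy)
  have := hpos.dotProduct_mulVec_nonneg v
  rw [star_trivial, sub_mulVec, Algebra.algebraMap_eq_smul_one, smul_mulVec, one_mulVec,
    dotProduct_sub, dotProduct_smul, smul_eq_mul] at this
  linarith

theorem Matrix.PosDef.lambdaMax_neg [Nonempty n] {X : Matrix n n ℝ} (hX : (-X).PosDef) :
    lambdaMax X < 0 := by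
  have hH : X.IsHermitian := by simpa using hX.isHermitian.neg
  obtain ⟨v, hv, h⟩ := hH.exists_mulVec_eq_lambdaMax
  have h1 := hX.dotProduct_mulVec_pos hv
  rw [star_trivial, neg_mulVec, h, dotProduct_neg, dotProduct_smul, smul_eq_mul] at h1
  by_contra! h2
  nlinarith [mul_nonneg h2 (dotProduct_self_pos hv).le]

theorem Matrix.PosDef.exists_le_dotProduct_mulVec {X : Matrix n n ℝ} (hX : X.PosDef) :
    ∃ c : ℝ, 0 < c ∧ ∀ v : n → ℝ, c * (v ⬝ᵥ v) ≤ v ⬝ᵥ X *ᵥ v := by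
  cases isEmpty_or_nonempty n
  · exact ⟨1, one_pos, fun v => by simp [dotProduct]⟩
  · have hX' : (-(-X)).PosDef := by simpa using hX
    refine ⟨-lambdaMax (-X), neg_pos.2 hX'.lambdaMax_neg, fun v => ?_⟩
    have := hX.isHermitian.neg.dotProduct_mulVec_le_lambdaMax v
    rw [neg_mulVec, dotProduct_neg] at this
    linarith

theorem Matrix.IsHermitian.exists_norm_eq_one_lambdaMax [Nonempty n] {X : Matrix n n ℝ}
    (hX : X.IsHermitian) :
    ∃ x : EuclideanSpace ℝ n, ‖x‖ = 1 ∧ x.ofLp ⬝ᵥ X *ᵥ x.ofLp = lambdaMax X := by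
  obtain ⟨v, hv, h⟩ := hX.exists_mulVec_eq_lambdaMax
  obtain ⟨y, rfl⟩ := (WithLp.equiv 2 (n → ℝ)).surjective v
  change y.ofLp ≠ 0 at hv
  change X *ᵥ y.ofLp = lambdaMax X • y.ofLp at h
  have hy : y ≠ 0 := fun h0 => hv (by rw [h0]; rfl)
  have hn : ‖y‖ ≠ 0 := norm_ne_zero_iff.2 hy
  refine ⟨‖y‖⁻¹ • y, ?_, ?_⟩
  · rw [norm_smul, norm_inv, norm_norm, inv_mul_cancel₀ hn]
  · rw [WithLp.ofLp_smul, mulVec_smul, smul_dotProduct, dotProduct_smul, h, dotProduct_smul,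
      ← EuclideanSpace.norm_sq_eq_dotProduct, smul_eq_mul, smul_eq_mul, smul_eq_mul]
    field_simp

/-- The largest eigenvalue of a continuous curve of symmetric matrices attains its maximum on a
compact interval. -/
theorem exists_isGreatest_lambdaMax [Nonempty n] {M : ℝ → Matrix n n ℝ} {a b : ℝ} (hab : a ≤ b)
    (hM : Continuous M) (hH : ∀ τ, (M τ).IsHermitian) :
    ∃ τ₀ ∈ Icc a b, IsGreatest ((fun τ => lambdaMax (M τ)) '' Icc a b) (lambdaMax (M τ₀)) := by
  -- The quadratic form is maximised jointly over τ and unit vectors, so continuity of `lambdaMax`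
  -- itself is never needed.
  have hK : IsCompact (Icc a b ×ˢ Metric.sphere (0 : EuclideanSpace ℝ n) 1) :=
    isCompact_Icc.prod (isCompact_sphere _ _)
  have hne : (Icc a b ×ˢ Metric.sphere (0 : EuclideanSpace ℝ n) 1).Nonempty := by
    obtain ⟨x, hx, -⟩ := (hH a).exists_norm_eq_one_lambdaMax
    exact ⟨(a, x), mk_mem_prod (left_mem_Icc.2 hab) (mem_sphere_zero_iff_norm.2 hx)⟩
  have hcont : Continuous fun q : ℝ × EuclideanSpace ℝ n =>
      q.2.ofLp ⬝ᵥ M q.1 *ᵥ q.2.ofLp := by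
    have h2 : Continuous fun q : ℝ × EuclideanSpace ℝ n => q.2.ofLp :=
      (PiLp.continuous_ofLp 2 _).comp continuous_snd
    exact h2.dotProduct ((hM.comp continuous_fst).matrix_mulVec h2)
  obtain ⟨q₀, hq, hmax⟩ := hK.exists_isMaxOn hne hcont.continuousOn
  rw [mem_prod, mem_sphere_zero_iff_norm] at hq
  refine ⟨q₀.1, hq.1, mem_image_of_mem _ hq.1, forall_mem_image.2 fun τ hτ => ?_⟩
  obtain ⟨x, hx, h⟩ := (hH τ).exists_norm_eq_one_lambdaMax
  have h1 := isMaxOn_iff.1 hmax (τ, x) (mk_mem_prod hτ (mem_sphere_zero_iff_norm.2 hx))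
  have h2 := (hH q₀.1).dotProduct_mulVec_le_lambdaMax q₀.2.ofLp
  rw [← EuclideanSpace.norm_sq_eq_dotProduct, hq.2, one_pow, mul_one] at h2
  exact (h.symm.le.trans h1).trans h2

end LambdaMax

/-! ### Absolutely continuous functions and differential inequalities. -/

section AbsolutelyContinuous

theorem AbsolutelyContinuousOnInterval.congr {X : Type*} [PseudoMetricSpace X] {f g : ℝ → X}
    {a b : ℝ} (hf : AbsolutelyContinuousOnInterval f a b) (h : EqOn f g (uIcc a b)) :
    AbsolutelyContinuousOnInterval g a b := by
  rw [absolutelyContinuousOnInterval_iff] at hf ⊢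
  intro ε hε
  obtain ⟨δ, hδ, H⟩ := hf ε hε
  refine ⟨δ, hδ, fun E hE hE' => ?_⟩
  convert H E hE hE' using 1
  refine Finset.sum_congr rfl fun i hi => ?_
  have := hE.1 i hi
  rw [h this.1, h this.2]

theorem LipschitzWith.comp_absolutelyContinuousOnInterval {X Y : Type*} [PseudoMetricSpace X]
    [PseudoMetricSpace Y] {f : ℝ → X} {g : X → Y} {K : NNReal} (hg : LipschitzWith K g) {a b : ℝ}
    (hf : AbsolutelyContinuousOnInterval f a b) :
    AbsolutelyContinuousOnInterval (fun t => g (f t)) a b := by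
  rw [absolutelyContinuousOnInterval_iff] at hf ⊢
  intro ε hε
  -- Dividing by `K + 1` rather than `K` covers `K = 0`.
  obtain ⟨δ, hδ, H⟩ := hf (ε / (K + 1)) (by positivity)
  refine ⟨δ, hδ, fun E hE hE' => ?_⟩
  have h1 := H E hE hE'
  rw [lt_div_iff₀ (by positivity)] at h1
  refine lt_of_le_of_lt ?_ h1
  rw [Finset.sum_mul]
  refine Finset.sum_le_sum fun i _ => (hg.dist_le_mul _ _).trans ?_
  nlinarith [dist_nonneg (x := f (E.2 i).1) (y := f (E.2 i).2)]

theorem AbsolutelyContinuousOnInterval.sum {ι : Type*} (s : Finset ι) {f : ι → ℝ → ℝ} {a b : ℝ}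
    (hf : ∀ i ∈ s, AbsolutelyContinuousOnInterval (f i) a b) :
    AbsolutelyContinuousOnInterval (fun t => ∑ i ∈ s, f i t) a b := by
  classical
  induction s using Finset.induction_on with
  | empty =>
    simpa using (LipschitzWith.const (0 : ℝ)).lipschitzOnWith.absolutelyContinuousOnInterval
  | insert i s hi ih =>
    simp only [Finset.sum_insert hi]
    exact (hf i (by simp)).fun_add (ih fun j hj => hf j (by simp [hj]))

/-- The fundamental theorem of calculus reduces this to monotonicity of the integral. An almost
everywhere bound is all that a hybrid solution provides. -/
theorem AbsolutelyContinuousOnInterval.sub_le_integral {f g : ℝ → ℝ} {a b : ℝ} (hab : a ≤ b)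
    (hf : AbsolutelyContinuousOnInterval f a b) (hg : IntervalIntegrable g volume a b)
    (h : ∀ᵐ t, t ∈ Ioo a b → ∃ f' ≤ g t, HasDerivAt f f' t) :
    f b - f a ≤ ∫ t in a..b, g t := by
  rw [← hf.integral_deriv_eq_sub]
  refine intervalIntegral.integral_mono_ae_restrict hab hf.intervalIntegrable_deriv hg ?_
  rw [Filter.EventuallyLE, restrict_Ioo_eq_restrict_Icc.symm, ae_restrict_iff' measurableSet_Ioo]
  filter_upwards [h] with t ht hm
  obtain ⟨f', hle, hd⟩ := ht hm
  rwa [hd.deriv]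

/-- If `f' ≤ -c f + d` almost everywhere, then `f` is bounded by the solution of the comparison
equation. -/
theorem AbsolutelyContinuousOnInterval.le_exp_mul {f : ℝ → ℝ} {a b c G : ℝ} (hab : a ≤ b)
    (hf : AbsolutelyContinuousOnInterval f a b)
    (h : ∀ᵐ t, t ∈ Ioo a b → ∃ f' ≤ -c * (f t - G), HasDerivAt f f' t) :
    f b - G ≤ Real.exp (-c * (b - a)) * (f a - G) := by
  -- Integrating factor: e^{ct}(f - G) has nonpositive derivative almost everywhere. The sign of `c`
  -- is free; a negative `c` gives a Grönwall growth bound.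
  have hexp : AbsolutelyContinuousOnInterval (fun t : ℝ => Real.exp (c * t)) a b := by
    refine ContDiffOn.absolutelyContinuousOnInterval ?_
    exact ((Real.contDiff_exp.comp (contDiff_const.mul contDiff_id)).of_le le_top).contDiffOn
  have hcst : AbsolutelyContinuousOnInterval (fun _ : ℝ => G) a b :=
    (LipschitzWith.const G).lipschitzOnWith.absolutelyContinuousOnInterval
  have hF := hexp.fun_mul (hf.fun_sub hcst)
  have := hF.sub_le_integral (g := fun _ => 0) hab intervalIntegrable_const (by
    filter_upwards [h] with t ht hm
    obtain ⟨f', hle, hd⟩ := ht hm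
    refine ⟨_, ?_, (((hasDerivAt_id t).const_mul c).exp).mul (hd.sub_const G)⟩
    have : 0 < Real.exp (c * t) := Real.exp_pos _
    simp only [id]
    nlinarith [mul_le_mul_of_nonneg_left hle this.le])
  simp only [intervalIntegral.integral_zero, sub_nonpos] at this
  have hs : Real.exp (-c * (b - a)) = Real.exp (c * a) / Real.exp (c * b) := by
    rw [← Real.exp_sub]; ring_nf
  rw [hs, div_mul_eq_mul_div, le_div_iff₀ (Real.exp_pos _)]
  linarith

end AbsolutelyContinuous

/-! ### Structure of hybrid time domains, induction and integration along them. -/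

section HybridTimeDomain

/-- `t` is a sequence of jump times of the hybrid time domain `E`. -/
structure IsSwitchingSequence (E : Set (ℝ × ℕ)) (t : ℕ → ℝ) : Prop where
  zero : t 0 = 0
  mono : Monotone t
  eq_Icc : ∀ i j, i < j → (hybridSlice E j).Nonempty → hybridSlice E i = Icc (t i) (t (i + 1))
  shape : ∀ j, (hybridSlice E j).Nonempty →
    (∃ T, t j ≤ T ∧ hybridSlice E j = Icc (t j) T) ∨
    (∃ T, t j < T ∧ hybridSlice E j = Ico (t j) T) ∨ hybridSlice E j = Ici (t j)

/-- The hybrid time domain with `J` jumps, the jump times `t`, and the last interval `I`. -/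
def hybridDomainUpTo (t : ℕ → ℝ) (J : ℕ) (I : Set ℝ) : Set (ℝ × ℕ) :=
  {p | (p.2 < J ∧ p.1 ∈ Icc (t p.2) (t (p.2 + 1))) ∨ (p.2 = J ∧ p.1 ∈ I)}

theorem hybridSlice_hybridDomainUpTo_of_lt {t : ℕ → ℝ} {j J : ℕ} (I : Set ℝ) (hj : j < J) :
    hybridSlice (hybridDomainUpTo t J I) j = Icc (t j) (t (j + 1)) := by
  ext s
  simp [hybridSlice, hybridDomainUpTo, hj, hj.ne]

theorem hybridSlice_hybridDomainUpTo_self (t : ℕ → ℝ) (J : ℕ) (I : Set ℝ) :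
    hybridSlice (hybridDomainUpTo t J I) J = I := by
  ext s
  simp [hybridSlice, hybridDomainUpTo]

theorem hybridSlice_hybridDomainUpTo_of_gt {t : ℕ → ℝ} {j J : ℕ} (I : Set ℝ) (hj : J < j) :
    hybridSlice (hybridDomainUpTo t J I) j = ∅ := by
  ext s
  simp [hybridSlice, hybridDomainUpTo, hj.not_gt, hj.ne']

theorem isSwitchingSequence_hybridDomainUpTo {t : ℕ → ℝ} (h0 : t 0 = 0) (hm : Monotone t) {J : ℕ}
    {I : Set ℝ} (hI : (∃ T, t J ≤ T ∧ I = Icc (t J) T) ∨ (∃ T, t J < T ∧ I = Ico (t J) T) ∨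
      I = Ici (t J)) : IsSwitchingSequence (hybridDomainUpTo t J I) t := by
  have hJ : ∀ j, (hybridSlice (hybridDomainUpTo t J I) j).Nonempty → j ≤ J := by
    intro j hj
    by_contra! h
    rw [hybridSlice_hybridDomainUpTo_of_gt I h] at hj
    exact not_nonempty_empty hj
  refine ⟨h0, hm, fun i j hij hj => hybridSlice_hybridDomainUpTo_of_lt I (hij.trans_le (hJ j hj)),
    fun j hj => ?_⟩
  rcases (hJ j hj).lt_or_eq with h | rfl
  · exact Or.inl ⟨_, hm (Nat.le_succ j), hybridSlice_hybridDomainUpTo_of_lt I h⟩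
  · rw [hybridSlice_hybridDomainUpTo_self]
    exact hI

/-- Domains with infinitely many jumps and domains with a last interval get a common interface,
which removes this case distinction from the estimates. -/
theorem IsHybridTimeDomain.exists_isSwitchingSequence {E : Set (ℝ × ℕ)}
    (hE : IsHybridTimeDomain E) : ∃ t, IsSwitchingSequence E t := by
  obtain ⟨t, h0, hm, rfl | ⟨J, I, hI, rfl⟩⟩ := hE
  · exact ⟨t, h0, hm, fun i j _ _ => rfl, fun j _ => Or.inl ⟨_, hm (Nat.le_succ j), rfl⟩⟩
  · exact ⟨t, isSwitchingSequence_hybridDomainUpTo h0 hm hI⟩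

namespace IsSwitchingSequence

variable {E : Set (ℝ × ℕ)} {t : ℕ → ℝ} (ht : IsSwitchingSequence E t)
include ht

theorem left_mem {j : ℕ} (hj : (hybridSlice E j).Nonempty) : t j ∈ hybridSlice E j := by
  rcases ht.shape j hj with ⟨T, hT, h⟩ | ⟨T, hT, h⟩ | h <;> rw [h]
  · exact left_mem_Icc.2 hT
  · exact left_mem_Ico.2 hT
  · exact self_mem_Ici

theorem left_le {j : ℕ} {s : ℝ} (hs : s ∈ hybridSlice E j) : t j ≤ s := by
  rcases ht.shape j ⟨s, hs⟩ with ⟨T, hT, h⟩ | ⟨T, hT, h⟩ | h <;> rw [h] at hs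
  · exact hs.1
  · exact hs.1
  · exact hs

theorem ordConnected (j : ℕ) : (hybridSlice E j).OrdConnected := by
  rcases (hybridSlice E j).eq_empty_or_nonempty with h | h
  · rw [h]; exact ordConnected_empty
  · rcases ht.shape j h with ⟨T, hT, h⟩ | ⟨T, hT, h⟩ | h <;> rw [h]
    · exact ordConnected_Icc
    · exact ordConnected_Ico
    · exact ordConnected_Ici

theorem nonempty_of_lt {i j : ℕ} (hij : i < j) (hj : (hybridSlice E j).Nonempty) :
    (hybridSlice E i).Nonempty := by
  rw [ht.eq_Icc i j hij hj]
  exact nonempty_Icc.2 (ht.mono (Nat.le_succ i))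

theorem right_mem {j : ℕ} (hj : (hybridSlice E (j + 1)).Nonempty) :
    t (j + 1) ∈ hybridSlice E j := by
  rw [ht.eq_Icc j _ (Nat.lt_succ_self j) hj]
  exact right_mem_Icc.2 (ht.mono (Nat.le_succ j))

theorem eq_of_mem_of_lt {i j : ℕ} (hij : i < j) {s : ℝ} (h : (s, i) ∈ E) (h' : (s, j) ∈ E) :
    s = t (i + 1) := by
  refine le_antisymm ?_ ((ht.mono hij).trans (ht.left_le h'))
  have h1 : s ∈ hybridSlice E i := h
  rw [ht.eq_Icc i _ hij ⟨s, h'⟩] at h1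
  exact h1.2

theorem Icc_subset {j : ℕ} {s : ℝ} (hs : s ∈ hybridSlice E j) :
    Icc (t j) s ⊆ hybridSlice E j :=
  (ht.ordConnected j).out (ht.left_mem ⟨s, hs⟩) hs

/-- Serves to pass estimates on compact pieces to a half-open or unbounded slice by monotone
convergence. -/
theorem exhaust {j : ℕ} (hj : (hybridSlice E j).Nonempty) :
    ∃ s : ℕ → ℝ, Monotone s ∧ (∀ n, s n ∈ hybridSlice E j) ∧
      hybridSlice E j = ⋃ n, Icc (t j) (s n) := by
  suffices ∃ s : ℕ → ℝ, Monotone s ∧ (∀ n, s n ∈ hybridSlice E j) ∧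
      ∀ x ∈ hybridSlice E j, ∃ n, x ≤ s n by
    obtain ⟨s, hm, hs, h⟩ := this
    refine ⟨s, hm, hs, subset_antisymm (fun x hx => ?_) (iUnion_subset fun n => ht.Icc_subset (hs n))⟩
    obtain ⟨n, hn⟩ := h x hx
    exact mem_iUnion.2 ⟨n, ht.left_le hx, hn⟩
  rcases ht.shape j hj with ⟨T, hT, h⟩ | ⟨T, hT, h⟩ | h <;> rw [h]
  · exact ⟨fun _ => T, monotone_const, fun _ => right_mem_Icc.2 hT, fun x hx => ⟨0, hx.2⟩⟩
  · obtain ⟨s, hs, hs', hlim⟩ := exists_seq_strictMono_tendsto' hT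
    refine ⟨s, hs.monotone, fun n => ⟨(hs' n).1.le, (hs' n).2⟩, fun x hx => ?_⟩
    obtain ⟨n, hn⟩ := (hlim.eventually (lt_mem_nhds hx.2)).exists
    exact ⟨n, hn.le⟩
  · refine ⟨fun n => t j + n, fun m n h => by simpa using h, fun n => by simp, fun x hx => ?_⟩
    obtain ⟨n, hn⟩ := exists_nat_ge (x - t j)
    exact ⟨n, by linarith⟩

theorem setLIntegral_le {j : ℕ} {f : ℝ → ℝ≥0∞} {K : ℝ≥0∞}
    (h : ∀ s ∈ hybridSlice E j, ∫⁻ x in Icc (t j) s, f x ≤ K) :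
    ∫⁻ x in hybridSlice E j, f x ≤ K := by
  rcases (hybridSlice E j).eq_empty_or_nonempty with h' | h'
  · simp [h']
  · obtain ⟨s, hm, hs, he⟩ := ht.exhaust h'
    rw [he, setLIntegral_iUnion_of_directed]
    · exact iSup_le fun n => h _ (hs n)
    · exact Monotone.directed_le fun m n hmn => Icc_subset_Icc_right (hm hmn)

/-- Induction along a hybrid time domain. -/
theorem induction {P : ℝ → ℕ → Prop} (h0 : P 0 0)
    (hflow : ∀ (j : ℕ) (a b : ℝ), a ≤ b → Icc a b ⊆ hybridSlice E j → P a j → P b j)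
    (hjump : ∀ (s : ℝ) (j : ℕ), (s, j) ∈ E → (s, j + 1) ∈ E → P s j → P s (j + 1))
    {s : ℝ} {j : ℕ} (hs : (s, j) ∈ E) : P s j := by
  suffices ∀ j, (hybridSlice E j).Nonempty → P (t j) j from
    hflow j _ _ (ht.left_le hs) (ht.Icc_subset hs) (this j ⟨s, hs⟩)
  intro j
  induction j with
  | zero => intro _; rwa [ht.zero]
  | succ j ih =>
    intro hj
    have hr := ht.right_mem hj
    exact hjump _ _ hr (ht.left_mem hj)
      (hflow j _ _ (ht.left_le hr) (ht.Icc_subset hr) (ih ⟨_, hr⟩))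

theorem zero_mem {s : ℝ} {j : ℕ} (hs : (s, j) ∈ E) : (0, 0) ∈ E := by
  have h : (hybridSlice E 0).Nonempty := by
    rcases Nat.eq_zero_or_pos j with rfl | hj
    · exact ⟨s, hs⟩
    · exact ht.nonempty_of_lt hj ⟨s, hs⟩
  have := ht.left_mem h
  rwa [ht.zero] at this

theorem measurableSet_slice (j : ℕ) : MeasurableSet (hybridSlice E j) :=
  (ht.ordConnected j).measurableSet

theorem aedisjoint_slice : Pairwise (Function.onFun (AEDisjoint volume) (hybridSlice E)) := by
  have key : ∀ i j, i < j → AEDisjoint volume (hybridSlice E i) (hybridSlice E j) := by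
    intro i j hij
    refine measure_mono_null (t := {t (i + 1)}) ?_ Real.volume_singleton
    rintro s ⟨h1, h2⟩
    exact ht.eq_of_mem_of_lt hij h1 h2
  intro i j hij
  rcases hij.lt_or_gt with h | h
  · exact key i j h
  · exact (key j i h).symm

/-- Integration over the time domain, slice by slice. -/
theorem setLIntegral_domTime (f : ℝ → ℕ → ℝ≥0∞) :
    ∫⁻ s in domTime E, f s (minJump E s) = ∑' j, ∫⁻ s in hybridSlice E j, f s j := by
  have hU : domTime E = ⋃ j, hybridSlice E j := by
    ext s; simp [domTime, hybridSlice]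
  rw [hU, lintegral_iUnion₀ (fun j => (ht.measurableSet_slice j).nullMeasurableSet)
    ht.aedisjoint_slice]
  refine tsum_congr fun j => ?_
  refine lintegral_congr_ae ?_
  rw [Filter.EventuallyEq, ae_restrict_iff' (ht.measurableSet_slice j)]
  -- Two slices can meet only at a jump time, so off this countable set `minJump` is the index of
  -- the slice.
  have hc : ∀ᵐ s : ℝ, s ∉ range t := (countable_range t).ae_notMem volume
  filter_upwards [hc] with s hs hj
  congr 1
  refine le_antisymm (Nat.sInf_le hj) ?_
  by_contra! hlt
  have hmem : (s, minJump E s) ∈ E := Nat.sInf_mem (s := {j | (s, j) ∈ E}) ⟨j, hj⟩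
  exact hs ⟨_, (ht.eq_of_mem_of_lt hlt hmem hj).symm⟩

end IsSwitchingSequence

end HybridTimeDomain

/-! ### Pointwise bounds from the norm of a hybrid signal. -/

section LinfNorm

variable {U : Type*} [NormedAddCommGroup U] {E : Set (ℝ × ℕ)}

theorem enorm_le_linfNorm_of_jump {u : ℝ → ℕ → U} {s : ℝ} {j : ℕ} (h : (s, j) ∈ E)
    (h' : (s, j + 1) ∈ E) : ‖u s j‖ₑ ≤ linfNorm E u := by
  refine le_trans ?_ (le_iSup (truncLinfNorm E u) (s + j))
  refine le_trans ?_ (le_max_right _ _)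
  exact le_iSup₂ (f := fun (p : ℝ × ℕ) (_ : p ∈ {p : ℝ × ℕ | p ∈ jumpTimes E ∧ p.1 + p.2 ≤ s + j}) =>
    ‖u p.1 p.2‖ₑ) (s, j) ⟨⟨h, h'⟩, le_rfl⟩

/-- The essential supremum sees only points outside Γ; points of Γ are covered by the supremum over
jumps. Integer truncation levels keep the exceptional null sets countable in number. -/
theorem IsSwitchingSequence.ae_enorm_le_linfNorm {t : ℕ → ℝ} (ht : IsSwitchingSequence E t)
    (u : ℝ → ℕ → U) (j : ℕ) :
    ∀ᵐ s : ℝ, (s, j) ∈ E → ‖u s j‖ₑ ≤ linfNorm E u := by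
  have h1 : ∀ T : ℕ, ∀ᵐ s ∂volume.restrict {s : ℝ | (s, j) ∈ E \ jumpTimes E ∧ s + j ≤ T},
      ‖u s j‖ₑ ≤ linfNorm E u := by
    intro T
    filter_upwards [ae_le_essSup (f := fun s => ‖u s j‖ₑ)
      (μ := volume.restrict {s : ℝ | (s, j) ∈ E \ jumpTimes E ∧ s + j ≤ T})] with s hs
    refine hs.trans (le_trans ?_ (le_iSup (truncLinfNorm E u) T))
    refine le_trans ?_ (le_max_left _ _)
    exact le_iSup (fun k : ℕ => essSup (fun s => ‖u s k‖ₑ)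
      (volume.restrict {s : ℝ | (s, k) ∈ E \ jumpTimes E ∧ s + k ≤ T})) j
  have hms : ∀ T : ℕ, MeasurableSet {s : ℝ | (s, j) ∈ E \ jumpTimes E ∧ s + j ≤ T} := by
    intro T
    have : {s : ℝ | (s, j) ∈ E \ jumpTimes E ∧ s + j ≤ T} =
        (hybridSlice E j \ hybridSlice E (j + 1)) ∩ {s : ℝ | s + j ≤ T} := by
      ext s
      simp only [hybridSlice, jumpTimes, mem_sdiff, mem_ofPred_eq, mem_inter_iff]
      tauto
    rw [this]
    exact ((ht.measurableSet_slice _).diff (ht.measurableSet_slice _)).inter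
      (measurableSet_le (by fun_prop) (by fun_prop))
  have h2 : ∀ T : ℕ, ∀ᵐ s : ℝ, ((s, j) ∈ E \ jumpTimes E ∧ s + j ≤ T) →
      ‖u s j‖ₑ ≤ linfNorm E u := fun T => (ae_restrict_iff' (hms T)).1 (h1 T)
  filter_upwards [ae_all_iff.2 h2] with s hs hE
  by_cases hj : (s, j + 1) ∈ E
  · exact enorm_le_linfNorm_of_jump hE hj
  · obtain ⟨T, hT⟩ := exists_nat_ge (s + j)
    exact hs T ⟨⟨hE, fun h => hj h.2⟩, hT⟩

end LinfNorm

/-! ### Calculus of quadratic forms. -/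

section QuadraticForm

variable {m n : Type*} [Fintype m] [Fintype n]

theorem dotProduct_matHe_mulVec (X : Matrix n n ℝ) (x : n → ℝ) :
    x ⬝ᵥ matHe X *ᵥ x = 2 * (x ⬝ᵥ X *ᵥ x) := by
  rw [matHe, add_mulVec, dotProduct_add, dotProduct_transpose_mulVec, two_mul]

theorem sumElim_dotProduct_fromBlocks_mulVec (X : Matrix m m ℝ) (Y : Matrix m n ℝ)
    (Z : Matrix n n ℝ) (x : m → ℝ) (y : n → ℝ) :
    Sum.elim x y ⬝ᵥ fromBlocks X Y Yᵀ Z *ᵥ Sum.elim x y =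
      x ⬝ᵥ X *ᵥ x + 2 * (x ⬝ᵥ Y *ᵥ y) + y ⬝ᵥ Z *ᵥ y := by
  rw [fromBlocks_mulVec, Sum.elim_comp_inl, Sum.elim_comp_inr, sumElim_dotProduct_sumElim,
    dotProduct_add, dotProduct_add, dotProduct_transpose_mulVec]
  ring

theorem Matrix.IsSymm.dotProduct_mulVec_comm {P : Matrix n n ℝ} (hP : P.IsSymm) (x y : n → ℝ) :
    x ⬝ᵥ P *ᵥ y = y ⬝ᵥ P *ᵥ x := by
  conv_lhs => rw [← hP.eq, dotProduct_transpose_mulVec]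

theorem HasDerivAt.dotProduct {f g : ℝ → n → ℝ} {f' g' : n → ℝ} {t : ℝ} (hf : HasDerivAt f f' t)
    (hg : HasDerivAt g g' t) :
    HasDerivAt (fun s => f s ⬝ᵥ g s) (f' ⬝ᵥ g t + f t ⬝ᵥ g') t := by
  simp only [_root_.dotProduct, ← Finset.sum_add_distrib]
  exact HasDerivAt.fun_sum fun i _ => (hasDerivAt_pi.1 hf i).mul (hasDerivAt_pi.1 hg i)

theorem HasDerivAt.mulVec (X : Matrix m n ℝ) {f : ℝ → n → ℝ} {f' : n → ℝ} {t : ℝ}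
    (hf : HasDerivAt f f' t) : HasDerivAt (fun s => X *ᵥ f s) (X *ᵥ f') t :=
  (LinearMap.toContinuousLinearMap X.mulVecLin).hasFDerivAt.comp_hasDerivAt t hf

theorem Matrix.IsSymm.hasDerivAt_dotProduct_mulVec {P : Matrix n n ℝ} (hP : P.IsSymm)
    {f : ℝ → n → ℝ} {f' : n → ℝ} {t : ℝ} (hf : HasDerivAt f f' t) :
    HasDerivAt (fun s => f s ⬝ᵥ P *ᵥ f s) (2 * (f t ⬝ᵥ P *ᵥ f')) t := by
  convert hf.dotProduct (hf.mulVec P) using 1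
  rw [hP.dotProduct_mulVec_comm f', two_mul]

theorem absolutelyContinuousOnInterval_dotProduct_mulVec (P : Matrix n n ℝ) {f : ℝ → n → ℝ}
    {a b : ℝ} (hf : ∀ i, AbsolutelyContinuousOnInterval (fun s => f s i) a b) :
    AbsolutelyContinuousOnInterval (fun s => f s ⬝ᵥ P *ᵥ f s) a b := by
  simp only [_root_.dotProduct, Matrix.mulVec]
  exact .sum _ fun i _ => (hf i).fun_mul (.sum _ fun k _ => (hf k).const_mul _)

end QuadraticForm

/-! ### The Lyapunov function and the quadratic form of the matrix inequality. -/

section Energy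

variable {nz ny nw nq ns np : ℕ}

/-- The Lyapunov function of the error system. -/
noncomputable def ErrState.energy (P₁ : Matrix (Fin nz) (Fin nz) ℝ)
    (P₂ : Matrix (Fin ny) (Fin ny) ℝ) (δ : ℝ) (x : ErrState nz ny) : ℝ :=
  x.ε ⬝ᵥ P₁ *ᵥ x.ε + Real.exp (δ * x.τ) * (x.θ ⬝ᵥ P₂ *ᵥ x.θ)

theorem ErrState.sumElim_ε_θ (x : ErrState nz ny) : Sum.elim x.ε x.θ = x.err := by
  ext (i | i) <;> rfl

theorem ErrState.err_dotProduct (x : ErrState nz ny) :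
    x.err ⬝ᵥ x.err = x.ε ⬝ᵥ x.ε + x.θ ⬝ᵥ x.θ := by
  rw [← x.sumElim_ε_θ, sumElim_dotProduct_sumElim]

/-- When `d` is the velocity of (ε, θ̃) and τ' = -1, the first two summands on the right are the
derivative of the energy; the term with -δ is the contribution of e^{δτ}. The terms with χ are the
multiplier for the Lipschitz bound. -/
theorem SampledPlant.matM_quadraticForm (p : SampledPlant nz ny nw nq ns np)
    (L : Matrix (Fin nz) (Fin ny) ℝ) (H : Matrix (Fin ny) (Fin ny) ℝ)
    {P₁ : Matrix (Fin nz) (Fin nz) ℝ} {P₂ : Matrix (Fin ny) (Fin ny) ℝ}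
    (hP₂ : P₂.IsSymm) (δ χ γ τ : ℝ) (ε : Fin nz → ℝ) (θ : Fin ny → ℝ)
    (w : Fin nw → ℝ) (ζ : Fin ns → ℝ) {d : Fin nz ⊕ Fin ny → ℝ}
    (hd : d = p.matF L H *ᵥ Sum.elim ε θ + p.matQ *ᵥ ζ + p.matT *ᵥ w) :
    Sum.elim (Sum.elim ε θ) (Sum.elim w ζ) ⬝ᵥ
        p.matM L H P₁ P₂ δ χ γ 0 τ *ᵥ Sum.elim (Sum.elim ε θ) (Sum.elim w ζ) =
      2 * (ε ⬝ᵥ P₁ *ᵥ (fun i => d (Sum.inl i))) +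
      Real.exp (δ * τ) * (2 * (θ ⬝ᵥ P₂ *ᵥ (fun i => d (Sum.inr i))) - δ * (θ ⬝ᵥ P₂ *ᵥ θ)) +
      (p.Cp *ᵥ ε) ⬝ᵥ (p.Cp *ᵥ ε) + χ * p.ell ^ 2 * ((p.S *ᵥ ε) ⬝ᵥ (p.S *ᵥ ε)) -
      γ ^ 2 * (w ⬝ᵥ w) - χ * (ζ ⬝ᵥ ζ) := by
  have h1 : (fun i => d (Sum.inl i)) =
      (p.A - L * p.C) *ᵥ ε + L *ᵥ θ + p.B *ᵥ ζ + p.N *ᵥ w := by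
    ext i
    simp [hd, SampledPlant.matF, SampledPlant.matQ, SampledPlant.matT, fromBlocks_mulVec,
      fromRows_mulVec]
  have h2 : (fun i => d (Sum.inr i)) =
      (p.C * p.A - p.C * L * p.C - H * p.C) *ᵥ ε + (p.C * L + H) *ᵥ θ + p.C *ᵥ (p.B *ᵥ ζ) +
        p.C *ᵥ (p.N *ᵥ w) := by
    ext i
    simp [hd, SampledPlant.matF, SampledPlant.matQ, SampledPlant.matT, fromBlocks_mulVec,
      fromRows_mulVec]
  -- Symmetry of `P₂` brings the transposed off-diagonal block to the form in which it occurs in the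
  -- derivative.
  have hK : ∀ K : Matrix (Fin ny) (Fin nz) ℝ, ε ⬝ᵥ Kᵀ *ᵥ (P₂ *ᵥ θ) = θ ⬝ᵥ P₂ *ᵥ (K *ᵥ ε) := by
    intro K
    rw [dotProduct_transpose_mulVec, dotProduct_comm, hP₂.dotProduct_mulVec_comm, dotProduct_comm,
      dotProduct_comm]
  have hsq : ∀ {k : ℕ} (K : Matrix (Fin k) (Fin nz) ℝ),
      ε ⬝ᵥ Kᵀ *ᵥ (K *ᵥ ε) = (K *ᵥ ε) ⬝ᵥ (K *ᵥ ε) := fun K => dotProduct_transpose_mulVec _ _ _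
  rw [h1, h2]
  simp only [SampledPlant.matM, sumElim_dotProduct_fromBlocks_mulVec]
  simp only [add_mulVec, dotProduct_add,
    dotProduct_matHe_mulVec, smul_mulVec, dotProduct_smul, ← mulVec_mulVec, fromBlocks_mulVec,
    Sum.elim_comp_inl, Sum.elim_comp_inr, sumElim_dotProduct_sumElim, hK, hsq, mulVec_add,
    smul_eq_mul, zero_mulVec, one_mulVec, neg_mulVec, dotProduct_neg, mul_zero,
    zero_sub, zero_smul, sub_mulVec, mulVec_sub, dotProduct_sub, add_zero, zero_add, neg_smul]
  ring

end Energy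

/-! ### Interpolation of the matrix inequality between the endpoints. -/

section MatM

variable {nz ny nw nq ns np : ℕ} (p : SampledPlant nz ny nw nq ns np)
  (L : Matrix (Fin nz) (Fin ny) ℝ) (H : Matrix (Fin ny) (Fin ny) ℝ)
  (P₁ : Matrix (Fin nz) (Fin nz) ℝ) (P₂ : Matrix (Fin ny) (Fin ny) ℝ) (δ χ γ : ℝ)

/-- The timer enters only through e^{δτ}, and every entry is affine in it. -/
theorem SampledPlant.matM_eq_combination {τ T r : ℝ}
    (hr : Real.exp (δ * τ) = (1 - r) * 1 + r * Real.exp (δ * T)) :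
    p.matM L H P₁ P₂ δ χ γ 0 τ =
      (1 - r) • p.matM L H P₁ P₂ δ χ γ 0 0 + r • p.matM L H P₁ P₂ δ χ γ 0 T := by
  ext ((i | i) | (i | i)) ((k | k) | (k | k)) <;>
    simp only [SampledPlant.matM, hr, Matrix.add_apply, Matrix.smul_apply, fromBlocks_apply₁₁,
      fromBlocks_apply₁₂, fromBlocks_apply₂₁, fromBlocks_apply₂₂, transpose_apply, smul_eq_mul,
      mul_zero, Real.exp_zero, Matrix.zero_apply] <;>
    ring

variable {p L H P₁ P₂ δ χ γ} {T : ℝ}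

theorem exp_mul_eq_combination (hδ : 0 < δ) (hT : 0 < T) (τ : ℝ) :
    Real.exp (δ * τ) = (1 - (Real.exp (δ * τ) - 1) / (Real.exp (δ * T) - 1)) * 1 +
      (Real.exp (δ * τ) - 1) / (Real.exp (δ * T) - 1) * Real.exp (δ * T) := by
  have : Real.exp (δ * T) - 1 ≠ 0 := (sub_pos.2 (Real.one_lt_exp_iff.2 (by positivity))).ne'
  field_simp
  ring

theorem SampledPlant.continuous_matM (hδ : 0 < δ) (hT : 0 < T) :
    Continuous fun τ => p.matM L H P₁ P₂ δ χ γ 0 τ := by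
  rw [funext fun τ => p.matM_eq_combination L H P₁ P₂ δ χ γ (exp_mul_eq_combination hδ hT τ)]
  fun_prop

theorem SampledPlant.isHermitian_matM (hδ : 0 < δ) (hT : 0 < T)
    (h0 : (p.matM L H P₁ P₂ δ χ γ 0 0).IsHermitian)
    (h1 : (p.matM L H P₁ P₂ δ χ γ 0 T).IsHermitian) (τ : ℝ) :
    (p.matM L H P₁ P₂ δ χ γ 0 τ).IsHermitian := by
  rw [p.matM_eq_combination L H P₁ P₂ δ χ γ (exp_mul_eq_combination hδ hT τ)]
  rw [IsHermitian, conjTranspose_add, conjTranspose_smul, conjTranspose_smul, h0.eq, h1.eq,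
    star_trivial, star_trivial]

theorem SampledPlant.posDef_neg_matM (hδ : 0 < δ) (hT : 0 < T)
    (h0 : (-(p.matM L H P₁ P₂ δ χ γ 0 0)).PosDef) (h1 : (-(p.matM L H P₁ P₂ δ χ γ 0 T)).PosDef)
    {τ : ℝ} (hτ : τ ∈ Icc 0 T) : (-(p.matM L H P₁ P₂ δ χ γ 0 τ)).PosDef := by
  rw [p.matM_eq_combination L H P₁ P₂ δ χ γ (exp_mul_eq_combination hδ hT τ)]
  have hD : 0 < Real.exp (δ * T) - 1 := sub_pos.2 (Real.one_lt_exp_iff.2 (by positivity))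
  have hr0 : 0 ≤ (Real.exp (δ * τ) - 1) / (Real.exp (δ * T) - 1) :=
    div_nonneg (sub_nonneg.2 (Real.one_le_exp (mul_nonneg hδ.le hτ.1))) hD.le
  have hr1 : (Real.exp (δ * τ) - 1) / (Real.exp (δ * T) - 1) ≤ 1 := by
    rw [div_le_one hD]
    gcongr
    exact hτ.2
  generalize (Real.exp (δ * τ) - 1) / (Real.exp (δ * T) - 1) = r at hr0 hr1
  rw [neg_add, ← smul_neg, ← smul_neg]
  -- For r > 0 the endpoint `T` carries definiteness, even when the weight 1 - r vanishes; r = 0 is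
  -- the other endpoint.
  rcases hr0.eq_or_lt with rfl | hr
  · simpa using h0
  · exact Matrix.PosDef.posSemidef_add (h0.posSemidef.smul (sub_nonneg.2 hr1)) (h1.smul hr)

end MatM

/-! ### Dissipation along flows, and energy versus distance to the attractor. -/

section Rate

variable {nz ny nw nq ns np : ℕ} {p : SampledPlant nz ny nw nq ns np}
  {L : Matrix (Fin nz) (Fin ny) ℝ} {H : Matrix (Fin ny) (Fin ny) ℝ}
  {P₁ : Matrix (Fin nz) (Fin nz) ℝ} {P₂ : Matrix (Fin ny) (Fin ny) ℝ} {δ χ γ : ℝ}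

theorem SampledPlant.zeta_dotProduct_le
    (hψ : ∀ v₁ v₂ : EuclideanSpace ℝ (Fin nq), ‖p.ψ v₁ - p.ψ v₂‖ ≤ p.ell * ‖v₁ - v₂‖)
    (v₁ v₂ : Fin nz → ℝ) :
    p.zeta v₁ v₂ ⬝ᵥ p.zeta v₁ v₂ ≤ p.ell ^ 2 * ((p.S *ᵥ v₂) ⬝ᵥ (p.S *ᵥ v₂)) := by
  have h := hψ (WithLp.toLp 2 (p.S *ᵥ v₁)) (WithLp.toLp 2 (p.S *ᵥ (v₁ - v₂)))
  have h2 := pow_le_pow_left₀ (norm_nonneg _) h 2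
  rw [mul_pow, EuclideanSpace.norm_sq_eq_dotProduct, EuclideanSpace.norm_sq_eq_dotProduct] at h2
  have h3 : (WithLp.toLp 2 (p.S *ᵥ v₁) - WithLp.toLp 2 (p.S *ᵥ (v₁ - v₂)) :
      EuclideanSpace ℝ (Fin nq)).ofLp = p.S *ᵥ v₂ := by
    rw [mulVec_sub]
    simp
  rw [h3] at h2
  exact h2

theorem ErrState.hasDerivAt_err {f : ℝ → ErrState nz ny} {z : Fin nz → ℝ}
    {d : Fin nz ⊕ Fin ny → ℝ} {c t : ℝ} (hf : HasDerivAt f (ErrState.mk z d c) t) :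
    HasDerivAt (fun s => (f s).ε) (fun i => d (Sum.inl i)) t ∧
      HasDerivAt (fun s => (f s).θ) (fun i => d (Sum.inr i)) t ∧
      HasDerivAt (fun s => (f s).τ) c t := by
  have h : ∀ i, HasDerivAt (fun s => f s i) ((ErrState.mk z d c) i) t := fun i =>
    (EuclideanSpace.proj i : ErrState nz ny →L[ℝ] ℝ).hasFDerivAt.comp_hasDerivAt t hf
  exact ⟨hasDerivAt_pi.2 fun i => h _, hasDerivAt_pi.2 fun i => h _, h _⟩

/-- The dissipation inequality along flows. -/
theorem SampledPlant.exists_hasDerivAt_energy_le (hχ : 0 < χ)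
    (hψ : ∀ v₁ v₂ : EuclideanSpace ℝ (Fin nq), ‖p.ψ v₁ - p.ψ v₂‖ ≤ p.ell * ‖v₁ - v₂‖)
    (hP₁ : P₁.IsSymm) (hP₂ : P₂.IsSymm) {β : ℝ} (hβ : 0 < β) {f : ℝ → ErrState nz ny}
    {u : ErrInput nw ny} {t : ℝ}
    (hM : ∀ v, v ⬝ᵥ p.matM L H P₁ P₂ δ χ γ 0 (f t).τ *ᵥ v ≤ -β * (v ⬝ᵥ v))
    (hf : HasDerivAt f ((p.errorSystem L H).flowMap (f t) u) t) :
    ∃ V' ≤ -β * ((f t).err ⬝ᵥ (f t).err) - ‖(p.errorSystem L H).output (f t)‖ ^ 2 +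
      γ ^ 2 * (u.w ⬝ᵥ u.w), HasDerivAt (fun s => (f s).energy P₁ P₂ δ) V' t := by
  obtain ⟨hε, hθ, hτ⟩ := ErrState.hasDerivAt_err hf
  refine ⟨_, ?_, (hP₁.hasDerivAt_dotProduct_mulVec hε).add
    ((hτ.const_mul δ).exp.mul (hP₂.hasDerivAt_dotProduct_mulVec hθ))⟩
  have h1 := p.matM_quadraticForm L H (P₁ := P₁) hP₂ δ χ γ (f t).τ (f t).ε (f t).θ u.w
    (p.zeta (f t).z (f t).ε) (by rw [ErrState.sumElim_ε_θ])
  have h2 := hM (Sum.elim (Sum.elim (f t).ε (f t).θ) (Sum.elim u.w (p.zeta (f t).z (f t).ε)))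
  rw [h1] at h2
  simp only [sumElim_dotProduct_sumElim] at h2
  have h3 := p.zeta_dotProduct_le hψ (f t).z (f t).ε
  have h4 : ‖(p.errorSystem L H).output (f t)‖ ^ 2 =
      (p.Cp *ᵥ (f t).ε) ⬝ᵥ (p.Cp *ᵥ (f t).ε) := EuclideanSpace.norm_sq_eq_dotProduct _
  -- The β-terms in w and ζ have a favourable sign and are dropped; χ times the Lipschitz bound
  -- disposes of the multiplier.
  rw [h4, ErrState.err_dotProduct]
  have h5 := mul_nonneg hβ.le (dotProduct_self_nonneg u.w)
  have h6 := mul_nonneg hβ.le (dotProduct_self_nonneg (p.zeta (f t).z (f t).ε))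
  have h7 := mul_le_mul_of_nonneg_left h3 hχ.le
  nlinarith

theorem ErrState.energy_le {x : ErrState nz ny} {T ρ₂ : ℝ} (hδ : 0 < δ) (hP₁ : P₁.PosDef)
    (hP₂ : P₂.PosDef) (hx : x.τ ≤ T) (h1 : lambdaMax P₁ ≤ ρ₂)
    (h2 : lambdaMax P₂ * Real.exp (δ * T) ≤ ρ₂) :
    x.energy P₁ P₂ δ ≤ ρ₂ * (x.err ⬝ᵥ x.err) := by
  rw [ErrState.energy, ErrState.err_dotProduct, mul_add]
  refine add_le_add ?_ ?_
  · exact (hP₁.isHermitian.dotProduct_mulVec_le_lambdaMax _).trans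
      (mul_le_mul_of_nonneg_right h1 (dotProduct_self_nonneg _))
  · have h3 : 0 ≤ x.θ ⬝ᵥ P₂ *ᵥ x.θ := by
      simpa using hP₂.posSemidef.dotProduct_mulVec_nonneg x.θ
    calc Real.exp (δ * x.τ) * (x.θ ⬝ᵥ P₂ *ᵥ x.θ)
        ≤ Real.exp (δ * T) * (x.θ ⬝ᵥ P₂ *ᵥ x.θ) := by gcongr
      _ ≤ Real.exp (δ * T) * (lambdaMax P₂ * (x.θ ⬝ᵥ x.θ)) := by
          gcongr
          exact hP₂.isHermitian.dotProduct_mulVec_le_lambdaMax _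
      _ = lambdaMax P₂ * Real.exp (δ * T) * (x.θ ⬝ᵥ x.θ) := by ring
      _ ≤ ρ₂ * (x.θ ⬝ᵥ x.θ) := mul_le_mul_of_nonneg_right h2 (dotProduct_self_nonneg _)

theorem ErrState.energy_nonneg (hP₁ : P₁.PosDef) (hP₂ : P₂.PosDef) (x : ErrState nz ny) :
    0 ≤ x.energy P₁ P₂ δ := by
  have h1 : 0 ≤ x.ε ⬝ᵥ P₁ *ᵥ x.ε := by
    simpa using hP₁.posSemidef.dotProduct_mulVec_nonneg x.ε
  have h3 : 0 ≤ x.θ ⬝ᵥ P₂ *ᵥ x.θ := by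
    simpa using hP₂.posSemidef.dotProduct_mulVec_nonneg x.θ
  exact add_nonneg h1 (mul_nonneg (Real.exp_pos _).le h3)

/-- For τ ≥ 0 the weight e^{δτ} is at least 1, so the coercivity constants of `P₁` and `P₂` suffice.
-/
theorem ErrState.exists_le_energy (hδ : 0 < δ) (hP₁ : P₁.PosDef) (hP₂ : P₂.PosDef) :
    ∃ c : ℝ, 0 < c ∧ ∀ x : ErrState nz ny, 0 ≤ x.τ → c * (x.err ⬝ᵥ x.err) ≤ x.energy P₁ P₂ δ := by
  obtain ⟨c₁, hc₁, h₁⟩ := hP₁.exists_le_dotProduct_mulVec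
  obtain ⟨c₂, hc₂, h₂⟩ := hP₂.exists_le_dotProduct_mulVec
  refine ⟨min c₁ c₂, lt_min hc₁ hc₂, fun x hx => ?_⟩
  rw [ErrState.energy, ErrState.err_dotProduct, mul_add]
  have hθ := dotProduct_self_nonneg x.θ
  refine add_le_add ((mul_le_mul_of_nonneg_right (min_le_left _ _) (dotProduct_self_nonneg _)).trans
    (h₁ _)) ?_
  have h4 : min c₁ c₂ * (x.θ ⬝ᵥ x.θ) ≤ x.θ ⬝ᵥ P₂ *ᵥ x.θ :=
    (mul_le_mul_of_nonneg_right (min_le_right _ _) hθ).trans (h₂ _)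
  refine h4.trans (le_mul_of_one_le_left ?_ (Real.one_le_exp (mul_nonneg hδ.le hx)))
  exact (mul_nonneg hc₂.le hθ).trans (h₂ _)

/-- The distance to the attractor is the norm of `(ε, θ̃)` when the timer is in its range. -/
theorem SampledPlant.infDist_attractor_sq {x : ErrState nz ny} (hx : x.τ ∈ Icc 0 p.T₂) :
    Metric.infDist x p.attractor ^ 2 = x.err ⬝ᵥ x.err := by
  have key : ∀ y ∈ p.attractor, x.err ⬝ᵥ x.err ≤ dist x y ^ 2 := by
    intro y hy
    have h0 : ∀ i, y (Sum.inr (Sum.inl i)) = 0 := by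
      rintro (i | i)
      · exact congrFun hy.1 i
      · exact congrFun hy.2.1 i
    rw [dist_eq_norm, EuclideanSpace.real_norm_sq_eq, Fintype.sum_sum_type, Fintype.sum_sum_type]
    have h1 : x.err ⬝ᵥ x.err = ∑ i, (x - y) (Sum.inr (Sum.inl i)) ^ 2 := by
      simp [dotProduct, h0, ErrState.err, pow_two]
    rw [h1]
    have h2 : 0 ≤ ∑ i, (x - y) (Sum.inl i) ^ 2 := Finset.sum_nonneg fun _ _ => sq_nonneg _
    have h3 : 0 ≤ ∑ i, (x - y) (Sum.inr (Sum.inr i)) ^ 2 :=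
      Finset.sum_nonneg fun _ _ => sq_nonneg _
    linarith
  -- The nearest point keeps z and τ; it lies in the attractor because the timer is in its range.
  set y : ErrState nz ny := ErrState.mk x.z 0 x.τ with hydef
  have hy : y ∈ p.attractor := ⟨rfl, rfl, hx⟩
  have hxy : dist x y ^ 2 = x.err ⬝ᵥ x.err := by
    rw [dist_eq_norm, EuclideanSpace.real_norm_sq_eq, Fintype.sum_sum_type, Fintype.sum_sum_type]
    simp [hydef, ErrState.mk, dotProduct, ErrState.err, ErrState.z, ErrState.τ, pow_two]
  have hn := dotProduct_self_nonneg x.err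
  refine le_antisymm ?_ ?_
  · rw [← hxy]
    exact pow_le_pow_left₀ Metric.infDist_nonneg (Metric.infDist_le_dist_of_mem hy) 2
  · rw [← Real.sqrt_le_left Metric.infDist_nonneg, Metric.le_infDist ⟨y, hy⟩]
    intro z hz
    rw [Real.sqrt_le_left dist_nonneg]
    exact key z hz

end Rate

/-- In the interior of an interval inside the slice, the derivative within the slice is an ordinary
derivative. -/
theorem IsSolutionPair.ae_hasDerivAt {X U Y : Type*} [NormedAddCommGroup X] [NormedSpace ℝ X]
    [NormedAddCommGroup U] {S : HybridSystem X U Y} {E : Set (ℝ × ℕ)} {φ : ℝ → ℕ → X}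
    {u : ℝ → ℕ → U} (hs : IsSolutionPair S E φ u) {j : ℕ} {a b : ℝ}
    (h : Icc a b ⊆ hybridSlice E j) :
    ∀ᵐ s : ℝ, s ∈ Ioo a b → φ s j ∈ S.flowSet ∧
      HasDerivAt (fun r => φ r j) (S.flowMap (φ s j) (u s j)) s := by
  filter_upwards [hs.flow j] with s hsj hm
  obtain ⟨h1, h2⟩ := hsj (h (Ioo_subset_Icc_self hm))
  exact ⟨h1, h2.hasDerivAt (Filter.mem_of_superset (Icc_mem_nhds hm.1 hm.2) h)⟩

/-! ### Timer and energy along solutions of the error system. -/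

section ErrorSystem

variable {nz ny nw nq ns np : ℕ} {p : SampledPlant nz ny nw nq ns np}
  {L : Matrix (Fin nz) (Fin ny) ℝ} {H : Matrix (Fin ny) (Fin ny) ℝ}
  {P₁ : Matrix (Fin nz) (Fin nz) ℝ} {P₂ : Matrix (Fin ny) (Fin ny) ℝ} {δ χ γ : ℝ}
  {E : Set (ℝ × ℕ)} {φ : ℝ → ℕ → ErrState nz ny} {u : ℝ → ℕ → ErrInput nw ny} {t : ℕ → ℝ}

theorem ErrState.absolutelyContinuousOnInterval_apply {f : ℝ → ErrState nz ny} {a b : ℝ}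
    (hf : AbsolutelyContinuousOnInterval f a b) (i : Fin nz ⊕ ((Fin nz ⊕ Fin ny) ⊕ Unit)) :
    AbsolutelyContinuousOnInterval (fun s => f s i) a b :=
  (EuclideanSpace.proj i : ErrState nz ny →L[ℝ] ℝ).lipschitz.comp_absolutelyContinuousOnInterval hf

theorem IsSolutionPair.τ_eq (hs : IsSolutionPair (p.errorSystem L H) E φ u) {j : ℕ} {a b : ℝ}
    (hab : a ≤ b) (h : Icc a b ⊆ hybridSlice E j) : (φ b j).τ = (φ a j).τ - (b - a) := by
  have hac : AbsolutelyContinuousOnInterval (fun s => (φ s j).τ) a b :=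
    ErrState.absolutelyContinuousOnInterval_apply (hs.arc j a b hab h) _
  have hd := hs.ae_hasDerivAt h
  have h1 := hac.sub_le_integral (g := fun _ => -1) hab intervalIntegrable_const (by
    filter_upwards [hd] with s hs hm
    exact ⟨_, le_rfl, (ErrState.hasDerivAt_err (hs hm).2).2.2⟩)
  have h2 := hac.fun_neg.sub_le_integral (g := fun _ => 1) hab intervalIntegrable_const (by
    filter_upwards [hd] with s hs hm
    exact ⟨_, by norm_num, (ErrState.hasDerivAt_err (hs hm).2).2.2.neg⟩)
  simp only [intervalIntegral.integral_const, smul_eq_mul] at h1 h2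
  linarith

theorem IsSolutionPair.jump_components (hs : IsSolutionPair (p.errorSystem L H) E φ u) {s : ℝ}
    {j : ℕ} (h : (s, j) ∈ E) (h' : (s, j + 1) ∈ E) :
    (φ s j).τ = 0 ∧ (φ s (j + 1)).τ ∈ Icc p.T₁ p.T₂ ∧ (φ s (j + 1)).ε = (φ s j).ε ∧
      (φ s (j + 1)).θ = -(u s j).η := by
  obtain ⟨h1, v, hv, h2⟩ := hs.jump s j h h'
  refine ⟨h1, ?_, ?_, ?_⟩
  · rw [h2]; exact hv
  · rw [h2]
    ext i
    simp [ErrState.mk, ErrState.ε, ErrState.err, fromBlocks_mulVec, fromRows_mulVec,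
      Function.comp_def]
  · rw [h2]
    ext i
    simp [ErrState.mk, ErrState.θ, ErrState.err, fromBlocks_mulVec, fromRows_mulVec, neg_mulVec]

/-- The flow set constrains a solution only almost everywhere. A negative timer at one instant
would, by `τ_eq`, be negative on an interval of positive length before it, which is a contradiction.
-/
theorem IsSolutionPair.τ_mem (ht : IsSwitchingSequence E t)
    (hs : IsSolutionPair (p.errorSystem L H) E φ u) (hT₁ : 0 ≤ p.T₁) (hT₂ : 0 ≤ p.T₂) {s : ℝ}
    {j : ℕ} (h : (s, j) ∈ E) : (φ s j).τ ∈ Icc 0 p.T₂ := by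
  refine ht.induction (P := fun s j => (φ s j).τ ∈ Icc 0 p.T₂) ?_ ?_ ?_ h
  · rcases hs.initial with h | h
    · exact h
    · exact ⟨(show _ = _ from h).ge, (show _ = _ from h).trans_le hT₂⟩
  · intro j a b hab hj ha
    have hb := hs.τ_eq hab hj
    refine ⟨?_, by rw [hb]; linarith [ha.2]⟩
    by_contra! hneg
    have hlt : a + (φ a j).τ < b := by linarith
    have hne : (ae (volume.restrict (Ioo (a + (φ a j).τ) b))).NeBot := by
      rw [ae_restrict_neBot]
      simp [hlt]
    have hae : ∀ᵐ r ∂volume.restrict (Ioo (a + (φ a j).τ) b),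
        r ∈ Ioo (a + (φ a j).τ) b ∧ (φ r j).τ ∈ Icc 0 p.T₂ := by
      rw [ae_restrict_iff' measurableSet_Ioo]
      filter_upwards [hs.ae_hasDerivAt hj] with r hr hm
      exact ⟨hm, (hr ⟨by linarith [hm.1, ha.1], hm.2⟩).1⟩
    obtain ⟨r, hr, hr'⟩ := hae.exists
    have har : a ≤ r := by linarith [hr.1, ha.1]
    have := hs.τ_eq har ((Icc_subset_Icc_right hr.2.le).trans hj)
    linarith [hr'.1, hr.1]
  · intro s j h1 h2 _
    have := (hs.jump_components h1 h2).2.1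
    exact ⟨hT₁.trans this.1, this.2⟩

/-- Consecutive jumps are separated by at least `T₁`. -/
theorem IsSolutionPair.mul_T₁_le (ht : IsSwitchingSequence E t)
    (hs : IsSolutionPair (p.errorSystem L H) E φ u) (hT₁ : 0 ≤ p.T₁) (hT₂ : 0 ≤ p.T₂) {s : ℝ}
    {j : ℕ} (h : (s, j) ∈ E) : j * p.T₁ ≤ s + p.T₂ := by
  -- The sum s + τ is constant along flows and grows by at least T₁ at each jump.
  suffices j * p.T₁ ≤ s + (φ s j).τ by linarith [(hs.τ_mem ht hT₁ hT₂ h).2]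
  refine ht.induction (P := fun s j => j * p.T₁ ≤ s + (φ s j).τ) ?_ ?_ ?_ h
  · simpa using (hs.τ_mem ht hT₁ hT₂ (ht.zero_mem h)).1
  · intro j a b hab hj ha
    linarith [hs.τ_eq hab hj]
  · intro s j h1 h2 h3
    obtain ⟨h4, h5, -⟩ := hs.jump_components h1 h2
    rw [h4] at h3
    push_cast
    linarith [h5.1]

theorem IsSolutionPair.absolutelyContinuousOnInterval_energy
    (hs : IsSolutionPair (p.errorSystem L H) E φ u) {j : ℕ} {a b : ℝ}
    (hab : a ≤ b) (h : Icc a b ⊆ hybridSlice E j) :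
    AbsolutelyContinuousOnInterval (fun s => (φ s j).energy P₁ P₂ δ) a b := by
  have hac := ErrState.absolutelyContinuousOnInterval_apply (hs.arc j a b hab h)
  refine (absolutelyContinuousOnInterval_dotProduct_mulVec P₁ fun i => hac _).fun_add
    (AbsolutelyContinuousOnInterval.fun_mul ?_
      (absolutelyContinuousOnInterval_dotProduct_mulVec P₂ fun i => hac _))
  -- The timer is explicit on the interval, so the exponential weight agrees there with a smooth
  -- function.
  have h1 : AbsolutelyContinuousOnInterval
      (fun s => Real.exp (δ * ((φ a j).τ - (s - a)))) a b := by
    refine ContDiffOn.absolutelyContinuousOnInterval ?_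
    exact (ContDiff.exp (by fun_prop)).contDiffOn
  refine h1.congr fun s hm => ?_
  rw [uIcc_of_le hab] at hm
  simp only [hs.τ_eq hm.1 ((Icc_subset_Icc_right hm.2).trans h)]

theorem ErrInput.norm_sq (v : ErrInput nw ny) : ‖v‖ ^ 2 = v.w ⬝ᵥ v.w + v.η ⬝ᵥ v.η := by
  rw [EuclideanSpace.norm_sq_eq_dotProduct, ← sumElim_dotProduct_sumElim]
  congr 1 <;> · ext (i | i) <;> rfl

/-- Decay of the energy along flows. -/
theorem IsSolutionPair.energy_flow_le (ht : IsSwitchingSequence E t)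
    (hs : IsSolutionPair (p.errorSystem L H) E φ u) (hT₁ : 0 ≤ p.T₁) (hT₂ : 0 ≤ p.T₂)
    (hχ : 0 < χ) (hδ : 0 < δ)
    (hψ : ∀ v₁ v₂ : EuclideanSpace ℝ (Fin nq), ‖p.ψ v₁ - p.ψ v₂‖ ≤ p.ell * ‖v₁ - v₂‖)
    (hP₁ : P₁.PosDef) (hP₂ : P₂.PosDef) {β ρ₂ U : ℝ} (hβ : 0 < β) (hρ₂ : 0 < ρ₂)
    (hM : ∀ τ ∈ Icc 0 p.T₂, ∀ v, v ⬝ᵥ p.matM L H P₁ P₂ δ χ γ 0 τ *ᵥ v ≤ -β * (v ⬝ᵥ v))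
    (h1 : lambdaMax P₁ ≤ ρ₂) (h2 : lambdaMax P₂ * Real.exp (δ * p.T₂) ≤ ρ₂) {j : ℕ}
    (hu : ∀ᵐ s : ℝ, (s, j) ∈ E → ‖u s j‖ ≤ U) {a b : ℝ}
    (hab : a ≤ b) (h : Icc a b ⊆ hybridSlice E j) :
    (φ b j).energy P₁ P₂ δ - γ ^ 2 * U ^ 2 / (β / ρ₂) ≤ Real.exp (-(β / ρ₂) * (b - a)) *
      ((φ a j).energy P₁ P₂ δ - γ ^ 2 * U ^ 2 / (β / ρ₂)) := by
  -- With c = β/ρ₂, the constant γ²U²/c is the equilibrium of v' = -c v + γ²U².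
  refine (hs.absolutelyContinuousOnInterval_energy hab h).le_exp_mul hab ?_
  filter_upwards [hs.ae_hasDerivAt h, hu] with s hd hus hm
  have hsE : (s, j) ∈ E := h (Ioo_subset_Icc_self hm)
  have hτ := hs.τ_mem ht hT₁ hT₂ hsE
  obtain ⟨V', hV', hder⟩ := SampledPlant.exists_hasDerivAt_energy_le hχ hψ hP₁.isHermitian
    hP₂.isHermitian hβ (hM _ hτ) (hd hm).2
  refine ⟨V', hV'.trans ?_, hder⟩
  have h3 := ErrState.energy_le hδ hP₁ hP₂ hτ.2 h1 h2
  have h4 : (u s j).w ⬝ᵥ (u s j).w ≤ U ^ 2 := by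
    have := pow_le_pow_left₀ (norm_nonneg _) (hus hsE) 2
    rw [ErrInput.norm_sq] at this
    linarith [dotProduct_self_nonneg (u s j).η]
  have h5 : -(β / ρ₂) * ((φ s j).energy P₁ P₂ δ - γ ^ 2 * U ^ 2 / (β / ρ₂)) =
      -(β / ρ₂) * (φ s j).energy P₁ P₂ δ + γ ^ 2 * U ^ 2 := by
    field_simp
    ring
  rw [h5]
  have h6 := mul_le_mul_of_nonneg_left h3 (div_pos hβ hρ₂).le
  have h7 : β / ρ₂ * (ρ₂ * ((φ s j).err ⬝ᵥ (φ s j).err)) = β * ((φ s j).err ⬝ᵥ (φ s j).err) := by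
    field_simp
  have h8 := mul_le_mul_of_nonneg_left h4 (sq_nonneg γ)
  have h9 := sq_nonneg ‖(p.errorSystem L H).output (φ s j)‖
  linarith

/-- ε is kept and θ̃ is overwritten by -η, so the old θ̃-term can be dropped; the new weight is at
most e^{δT₂}. -/
theorem IsSolutionPair.energy_jump_le (hs : IsSolutionPair (p.errorSystem L H) E φ u)
    (hδ : 0 < δ) (hP₂ : P₂.PosDef) {s : ℝ} {j : ℕ} (h : (s, j) ∈ E) (h' : (s, j + 1) ∈ E) :
    (φ s (j + 1)).energy P₁ P₂ δ ≤ (φ s j).energy P₁ P₂ δ +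
      Real.exp (δ * p.T₂) * ((u s j).η ⬝ᵥ P₂ *ᵥ (u s j).η) := by
  obtain ⟨-, h2, h3, h4⟩ := hs.jump_components h h'
  have h5 : ∀ v, 0 ≤ v ⬝ᵥ P₂ *ᵥ v := fun v => by
    simpa using hP₂.posSemidef.dotProduct_mulVec_nonneg v
  rw [ErrState.energy, ErrState.energy, h3, h4]
  have h6 : -(u s j).η ⬝ᵥ P₂ *ᵥ -(u s j).η = (u s j).η ⬝ᵥ P₂ *ᵥ (u s j).η := by
    simp [mulVec_neg]
  rw [h6]
  have h7 : Real.exp (δ * (φ s (j + 1)).τ) ≤ Real.exp (δ * p.T₂) :=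
    Real.exp_le_exp.2 (mul_le_mul_of_nonneg_left h2.2 hδ.le)
  have h8 := mul_le_mul_of_nonneg_right h7 (h5 (u s j).η)
  have h9 := mul_nonneg (Real.exp_pos (δ * (φ s j).τ)).le (h5 (φ s j).θ)
  linarith

/-- The energy decays exponentially with the flow time, up to a multiple of the squared
amplitude of the input. -/
theorem SampledPlant.exists_energy_le (p : SampledPlant nz ny nw nq ns np)
    (hT₁ : 0 < p.T₁) (hT₂ : 0 ≤ p.T₂) (hχ : 0 < χ) (hδ : 0 < δ)
    (hψ : ∀ v₁ v₂ : EuclideanSpace ℝ (Fin nq), ‖p.ψ v₁ - p.ψ v₂‖ ≤ p.ell * ‖v₁ - v₂‖)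
    (hP₁ : P₁.PosDef) (hP₂ : P₂.PosDef) {β ρ₂ : ℝ} (hβ : 0 < β) (hρ₂ : 0 < ρ₂)
    (hM : ∀ τ ∈ Icc 0 p.T₂, ∀ v, v ⬝ᵥ p.matM L H P₁ P₂ δ χ γ 0 τ *ᵥ v ≤ -β * (v ⬝ᵥ v))
    (h1 : lambdaMax P₁ ≤ ρ₂) (h2 : lambdaMax P₂ * Real.exp (δ * p.T₂) ≤ ρ₂) :
    ∃ K : ℝ, 0 ≤ K ∧ ∀ (E : Set (ℝ × ℕ)) (φ : ℝ → ℕ → ErrState nz ny)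
      (u : ℝ → ℕ → ErrInput nw ny), IsSolutionPair (p.errorSystem L H) E φ u →
      linfNorm E u < ∞ → ∀ (s : ℝ) (j : ℕ), (s, j) ∈ E →
        (φ s j).energy P₁ P₂ δ ≤ Real.exp (-(β / ρ₂) * s) * (φ 0 0).energy P₁ P₂ δ +
          K * (linfNorm E u).toReal ^ 2 := by
  set c := β / ρ₂ with hc
  have hc0 : 0 < c := div_pos hβ hρ₂
  have hq : 0 < Real.exp (c * p.T₁) - 1 := sub_pos.2 (Real.one_lt_exp_iff.2 (by positivity))
  -- Chosen so that D(e^{cT₁} - 1) = ρ₂, the bound for the energy added at a jump per unit of U².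
  set D := ρ₂ / (Real.exp (c * p.T₁) - 1) with hD
  have hD0 : 0 < D := div_pos hρ₂ hq
  refine ⟨γ ^ 2 / c + D * Real.exp (c * p.T₂), by positivity, fun E φ u hs hfin s j hE => ?_⟩
  obtain ⟨t, ht⟩ := hs.domain.exists_isSwitchingSequence
  set U := (linfNorm E u).toReal with hU
  have hnorm : ∀ v : ErrInput nw ny, ‖v‖ₑ ≤ linfNorm E u → ‖v‖ ≤ U := fun v hv => by
    rw [← toReal_enorm]
    exact ENNReal.toReal_mono hfin.ne hv
  have hu : ∀ j, ∀ᵐ s : ℝ, (s, j) ∈ E → ‖u s j‖ ≤ U := fun j => by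
    filter_upwards [ht.ae_enorm_le_linfNorm u j] with s h h'
    exact hnorm _ (h h')
  -- Strengthened invariant: e^{cτ} shrinks along flows exactly by the factor e^{-c(b-a)}, and at a
  -- jump it rises from 1 to at least e^{cT₁}, which pays for the increment.
  suffices (φ s j).energy P₁ P₂ δ ≤ Real.exp (-c * s) * (φ 0 0).energy P₁ P₂ δ +
      γ ^ 2 * U ^ 2 / c + D * U ^ 2 * Real.exp (c * (φ s j).τ) by
    have h3 : Real.exp (c * (φ s j).τ) ≤ Real.exp (c * p.T₂) :=
      Real.exp_le_exp.2 (mul_le_mul_of_nonneg_left (hs.τ_mem ht hT₁.le hT₂ hE).2 hc0.le)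
    have h4 := mul_le_mul_of_nonneg_left h3 (mul_nonneg hD0.le (sq_nonneg U))
    have h5 : (γ ^ 2 / c + D * Real.exp (c * p.T₂)) * U ^ 2 =
      γ ^ 2 * U ^ 2 / c + D * U ^ 2 * Real.exp (c * p.T₂) := by ring
    linarith
  refine ht.induction (P := fun s j => (φ s j).energy P₁ P₂ δ ≤
    Real.exp (-c * s) * (φ 0 0).energy P₁ P₂ δ +
      γ ^ 2 * U ^ 2 / c + D * U ^ 2 * Real.exp (c * (φ s j).τ)) ?_ ?_ ?_ hE
  · have : 0 ≤ γ ^ 2 * U ^ 2 / c + D * U ^ 2 * Real.exp (c * (φ 0 0).τ) := by positivity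
    rw [mul_zero, Real.exp_zero, one_mul]
    linarith
  · intro j a b hab hj ha
    have h3 := hs.energy_flow_le ht hT₁.le hT₂ hχ hδ hψ hP₁ hP₂ hβ hρ₂ hM h1 h2 (hu j) hab hj
    rw [← hc] at h3
    have h4 := mul_le_mul_of_nonneg_left (sub_le_sub_right ha (γ ^ 2 * U ^ 2 / c))
      (Real.exp_pos (-c * (b - a))).le
    have h5 : Real.exp (-c * b) = Real.exp (-c * (b - a)) * Real.exp (-c * a) := by
      rw [← Real.exp_add]; ring_nf
    have h6 : Real.exp (c * (φ b j).τ) = Real.exp (-c * (b - a)) * Real.exp (c * (φ a j).τ) := by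
      rw [← Real.exp_add, hs.τ_eq hab hj]; ring_nf
    rw [h5, h6]
    linarith
  · intro s j h3 h4 h5
    obtain ⟨h6, h7, -⟩ := hs.jump_components h3 h4
    rw [h6, mul_zero, Real.exp_zero, mul_one] at h5
    have h8 := hs.energy_jump_le (P₁ := P₁) hδ hP₂ h3 h4
    have h9 : Real.exp (δ * p.T₂) * ((u s j).η ⬝ᵥ P₂ *ᵥ (u s j).η) ≤ ρ₂ * U ^ 2 := by
      have e1 := hP₂.isHermitian.dotProduct_mulVec_le_lambdaMax (u s j).η
      have e2 := pow_le_pow_left₀ (norm_nonneg _) (hnorm _ (enorm_le_linfNorm_of_jump h3 h4)) 2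
      rw [ErrInput.norm_sq] at e2
      have e3 := dotProduct_self_nonneg (u s j).η
      calc Real.exp (δ * p.T₂) * ((u s j).η ⬝ᵥ P₂ *ᵥ (u s j).η)
          ≤ Real.exp (δ * p.T₂) * (lambdaMax P₂ * ((u s j).η ⬝ᵥ (u s j).η)) := by gcongr
        _ = lambdaMax P₂ * Real.exp (δ * p.T₂) * ((u s j).η ⬝ᵥ (u s j).η) := by ring
        _ ≤ ρ₂ * ((u s j).η ⬝ᵥ (u s j).η) := by gcongr
        _ ≤ ρ₂ * U ^ 2 := by
          gcongr
          linarith [dotProduct_self_nonneg (u s j).w]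
    have h10 : Real.exp (c * p.T₁) ≤ Real.exp (c * (φ s (j + 1)).τ) :=
      Real.exp_le_exp.2 (mul_le_mul_of_nonneg_left h7.1 hc0.le)
    have h11 := mul_le_mul_of_nonneg_left h10 (mul_nonneg hD0.le (sq_nonneg U))
    have h12 : D * (Real.exp (c * p.T₁) - 1) = ρ₂ := by rw [hD]; field_simp
    have h13 : D * U ^ 2 * Real.exp (c * p.T₁) = D * U ^ 2 + ρ₂ * U ^ 2 := by
      rw [← h12]; ring
    linarith

end ErrorSystem

/-! ### Decay rate, input-to-state stability and gain. -/

section Estimates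

variable {nz ny nw nq ns np : ℕ} {p : SampledPlant nz ny nw nq ns np}
  {L : Matrix (Fin nz) (Fin ny) ℝ} {H : Matrix (Fin ny) (Fin ny) ℝ}
  {P₁ : Matrix (Fin nz) (Fin nz) ℝ} {P₂ : Matrix (Fin ny) (Fin ny) ℝ} {δ χ γ β ρ₂ : ℝ}

theorem SampledPlant.hasFlowTimeDecayRate (hT₁ : 0 < p.T₁) (hT₂ : 0 ≤ p.T₂) (hχ : 0 < χ)
    (hδ : 0 < δ)
    (hψ : ∀ v₁ v₂ : EuclideanSpace ℝ (Fin nq), ‖p.ψ v₁ - p.ψ v₂‖ ≤ p.ell * ‖v₁ - v₂‖)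
    (hP₁ : P₁.PosDef) (hP₂ : P₂.PosDef) (hβ : 0 < β) (hρ₂ : 0 < ρ₂)
    (hM : ∀ τ ∈ Icc 0 p.T₂, ∀ v, v ⬝ᵥ p.matM L H P₁ P₂ δ χ γ 0 τ *ᵥ v ≤ -β * (v ⬝ᵥ v))
    (h1 : lambdaMax P₁ ≤ ρ₂) (h2 : lambdaMax P₂ * Real.exp (δ * p.T₂) ≤ ρ₂) :
    HasFlowTimeDecayRate (p.errorSystem L H) p.attractor (β / (2 * ρ₂)) := by
  obtain ⟨K, hK, hV⟩ := p.exists_energy_le hT₁ hT₂ hχ hδ hψ hP₁ hP₂ hβ hρ₂ hM h1 h2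
  obtain ⟨c, hc, hcV⟩ := ErrState.exists_le_energy (δ := δ) hδ hP₁ hP₂
  have hA : 0 < √(ρ₂ / c) := Real.sqrt_pos.2 (div_pos hρ₂ hc)
  have hB : 0 ≤ √(K / c) := Real.sqrt_nonneg _
  -- The factors 2 turn a sum into a maximum; the summand 1 keeps the gain strictly increasing if `K
  -- = 0`.
  refine ⟨2 * √(ρ₂ / c), fun s => (2 * √(K / c) + 1) * s, by positivity, ⟨by fun_prop, ?_, by simp⟩,
    fun E φ u hs hfin s j hE => ?_⟩
  · intro x _ y _ hxy
    exact mul_lt_mul_of_pos_left hxy (by positivity)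
  obtain ⟨t, ht⟩ := hs.domain.exists_isSwitchingSequence
  have hτ := hs.τ_mem ht hT₁.le hT₂ hE
  have hτ0 := hs.τ_mem ht hT₁.le hT₂ (ht.zero_mem hE)
  set r := Metric.infDist (φ s j) p.attractor
  set r₀ := Metric.infDist (φ 0 0) p.attractor
  set U := (linfNorm E u).toReal
  have hr : 0 ≤ r := Metric.infDist_nonneg
  have hr₀ : 0 ≤ r₀ := Metric.infDist_nonneg
  have hU : 0 ≤ U := ENNReal.toReal_nonneg
  have e1 := hV E φ u hs hfin s j hE
  have e2 := hcV (φ s j) hτ.1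
  have e3 := ErrState.energy_le hδ hP₁ hP₂ hτ0.2 h1 h2
  rw [← p.infDist_attractor_sq hτ] at e2
  rw [← p.infDist_attractor_sq hτ0] at e3
  have e4 := mul_le_mul_of_nonneg_left e3 (Real.exp_pos (-(β / ρ₂) * s)).le
  have e5 : r ^ 2 ≤ (√(ρ₂ / c) * Real.exp (-(β / (2 * ρ₂)) * s) * r₀) ^ 2 +
      (√(K / c) * U) ^ 2 := by
    rw [mul_pow, mul_pow, mul_pow, Real.sq_sqrt (by positivity), Real.sq_sqrt (by positivity),
      ← Real.exp_nat_mul]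
    have e6 : ((2 : ℕ) : ℝ) * (-(β / (2 * ρ₂)) * s) = -(β / ρ₂) * s := by
      push_cast
      field_simp
    rw [e6]
    have e7 : c * (ρ₂ / c * Real.exp (-(β / ρ₂) * s) * r₀ ^ 2 + K / c * U ^ 2) =
        Real.exp (-(β / ρ₂) * s) * (ρ₂ * r₀ ^ 2) + K * U ^ 2 := by
      field_simp
    refine le_of_mul_le_mul_left ?_ hc
    rw [e7]
    linarith
  have hx : 0 ≤ √(ρ₂ / c) * Real.exp (-(β / (2 * ρ₂)) * s) * r₀ := by positivity
  have hy : 0 ≤ √(K / c) * U := by positivity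
  have e8 : r ≤ √(ρ₂ / c) * Real.exp (-(β / (2 * ρ₂)) * s) * r₀ + √(K / c) * U := by
    refine le_of_sq_le_sq ?_ (by positivity)
    nlinarith
  rcases le_total (√(ρ₂ / c) * Real.exp (-(β / (2 * ρ₂)) * s) * r₀) (√(K / c) * U) with h | h
  · refine le_max_of_le_right ?_
    linarith
  · refine le_max_of_le_left ?_
    linarith

theorem SampledPlant.isPreEISS (hT₁ : 0 < p.T₁) (hT₂ : 0 ≤ p.T₂) {r : ℝ} (hr : 0 < r)
    (h : HasFlowTimeDecayRate (p.errorSystem L H) p.attractor r) :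
    IsPreEISS (p.errorSystem L H) p.attractor := by
  obtain ⟨κ, ρ, hκ, hρ, hest⟩ := h
  -- Since j ≤ (s + T₂)/T₁, this choice gives lam(s + j) ≤ r s + lam T₂/T₁, and the constant goes
  -- into the overshoot.
  set lam := r / (1 + 1 / p.T₁) with hlam
  have hlam0 : 0 < lam := by positivity
  refine ⟨κ * Real.exp (lam * (p.T₂ / p.T₁)), lam, ρ, by positivity, hlam0, hρ,
    fun E φ u hs hfin s j hE => ?_⟩
  obtain ⟨t, ht⟩ := hs.domain.exists_isSwitchingSequence
  refine (hest E φ u hs hfin s j hE).trans (max_le_max_right _ ?_)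
  refine mul_le_mul_of_nonneg_right ?_ Metric.infDist_nonneg
  rw [mul_assoc, ← Real.exp_add]
  refine mul_le_mul_of_nonneg_left (Real.exp_le_exp.2 ?_) hκ.le
  have h1 : (j : ℝ) ≤ (s + p.T₂) / p.T₁ := by
    rw [le_div_iff₀ hT₁]
    exact hs.mul_T₁_le ht hT₁.le hT₂ hE
  have h2 : lam * (1 + 1 / p.T₁) = r := by rw [hlam]; field_simp
  have h3 : lam * (1 + 1 / p.T₁) * s = lam * s + lam * (s / p.T₁) := by ring
  rw [h2] at h3
  have h4 := mul_le_mul_of_nonneg_left h1 hlam0.le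
  rw [add_div, mul_add] at h4
  linarith

/-- The integrated dissipation inequality along flows. -/
theorem IsSolutionPair.energy_add_lintegral_le {E : Set (ℝ × ℕ)} {φ : ℝ → ℕ → ErrState nz ny}
    {u : ℝ → ℕ → ErrInput nw ny} {t : ℕ → ℝ} (ht : IsSwitchingSequence E t)
    (hs : IsSolutionPair (p.errorSystem L H) E φ u) (hT₁ : 0 ≤ p.T₁) (hT₂ : 0 ≤ p.T₂)
    (hχ : 0 < χ) (hγ : 0 ≤ γ)
    (hψ : ∀ v₁ v₂ : EuclideanSpace ℝ (Fin nq), ‖p.ψ v₁ - p.ψ v₂‖ ≤ p.ell * ‖v₁ - v₂‖)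
    (hP₁ : P₁.PosDef) (hP₂ : P₂.PosDef) (hβ : 0 < β)
    (hM : ∀ τ ∈ Icc 0 p.T₂, ∀ v, v ⬝ᵥ p.matM L H P₁ P₂ δ χ γ 0 τ *ᵥ v ≤ -β * (v ⬝ᵥ v))
    {j : ℕ} {a b : ℝ} (hab : a ≤ b) (h : Icc a b ⊆ hybridSlice E j) :
    (∫⁻ s in Icc a b, ‖(p.errorSystem L H).output (φ s j)‖ₑ ^ 2) +
        ENNReal.ofReal ((φ b j).energy P₁ P₂ δ) ≤
      ENNReal.ofReal ((φ a j).energy P₁ P₂ δ) + ENNReal.ofReal γ ^ 2 *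
        ∫⁻ s in Icc a b, ‖(WithLp.toLp 2 (u s j).w : EuclideanSpace ℝ (Fin nw))‖ₑ ^ 2 := by
  have hφ : ContinuousOn (fun s => φ s j) (Icc a b) := by
    have := (hs.arc j a b hab h).continuousOn
    rwa [uIcc_of_le hab] at this
  have hout : Continuous (p.errorSystem L H).output := by
    refine (PiLp.continuous_toLp 2 _).comp (continuous_const.matrix_mulVec ?_)
    exact continuous_pi fun i => (EuclideanSpace.proj _ : ErrState nz ny →L[ℝ] ℝ).continuous
  have hw : Continuous fun v : ErrInput nw ny =>
      (WithLp.toLp 2 v.w : EuclideanSpace ℝ (Fin nw)) := by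
    refine (PiLp.continuous_toLp 2 _).comp ?_
    exact continuous_pi fun i => (EuclideanSpace.proj _ : ErrInput nw ny →L[ℝ] ℝ).continuous
  have hyi : IntegrableOn (fun s => ‖(p.errorSystem L H).output (φ s j)‖ ^ 2) (Icc a b) :=
    ((hout.comp_continuousOn hφ).norm.pow 2).integrableOn_Icc
  -- Local essential boundedness of the input suffices here; no global bound is assumed.
  have hwi : IntegrableOn
      (fun s => ‖(WithLp.toLp 2 (u s j).w : EuclideanSpace ℝ (Fin nw))‖ ^ 2) (Icc a b) := by
    obtain ⟨hmeas, hbd⟩ := hs.input j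
    obtain ⟨K, hK⟩ := hbd b
    have hm : AEStronglyMeasurable (fun s => u s j) (volume.restrict (Icc a b)) :=
      hmeas.mono_measure (Measure.restrict_mono_set _ h)
    refine Integrable.of_bound ((hw.comp_aestronglyMeasurable hm).norm.pow 2) (K ^ 2) ?_
    have hK' : ∀ᵐ s ∂volume.restrict (Icc a b), ‖u s j‖ ≤ K :=
      ae_restrict_of_ae_restrict_of_subset (subset_inter h Icc_subset_Iic_self) hK
    filter_upwards [hK'] with s hs
    have h1 := pow_le_pow_left₀ (norm_nonneg _) hs 2
    rw [ErrInput.norm_sq] at h1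
    rw [Real.norm_of_nonneg (sq_nonneg _), EuclideanSpace.norm_sq_eq_dotProduct]
    change (u s j).w ⬝ᵥ (u s j).w ≤ _
    linarith [dotProduct_self_nonneg (u s j).η]
  have hgi : IntegrableOn (fun s =>
      γ ^ 2 * ‖(WithLp.toLp 2 (u s j).w : EuclideanSpace ℝ (Fin nw))‖ ^ 2 -
        ‖(p.errorSystem L H).output (φ s j)‖ ^ 2) (Icc a b) := (hwi.const_mul (γ ^ 2)).sub hyi
  have key := (hs.absolutelyContinuousOnInterval_energy (P₁ := P₁) (P₂ := P₂) (δ := δ)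
    hab h).sub_le_integral (g := fun s =>
      γ ^ 2 * ‖(WithLp.toLp 2 (u s j).w : EuclideanSpace ℝ (Fin nw))‖ ^ 2 -
        ‖(p.errorSystem L H).output (φ s j)‖ ^ 2) hab
    ((intervalIntegrable_iff_integrableOn_Icc_of_le hab).2 hgi) (by
      filter_upwards [hs.ae_hasDerivAt h] with s hd hm
      obtain ⟨V', hV', hder⟩ := SampledPlant.exists_hasDerivAt_energy_le hχ hψ hP₁.isHermitian
        hP₂.isHermitian hβ (hM _ (hs.τ_mem ht hT₁ hT₂ (h (Ioo_subset_Icc_self hm)))) (hd hm).2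
      refine ⟨V', hV'.trans ?_, hder⟩
      rw [EuclideanSpace.norm_sq_eq_dotProduct (WithLp.toLp 2 (u s j).w)]
      have := mul_nonneg hβ.le (dotProduct_self_nonneg (φ s j).err)
      linarith)
  rw [intervalIntegral.integral_of_le hab, ← integral_Icc_eq_integral_Ioc,
    integral_sub (hwi.const_mul _) hyi, integral_const_mul] at key
  have hy : ∫⁻ s in Icc a b, ‖(p.errorSystem L H).output (φ s j)‖ₑ ^ 2 =
      ENNReal.ofReal (∫ s in Icc a b, ‖(p.errorSystem L H).output (φ s j)‖ ^ 2) := by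
    rw [ofReal_integral_eq_lintegral_ofReal hyi (.of_forall fun s => sq_nonneg _)]
    exact lintegral_congr fun s => by
      rw [ENNReal.ofReal_pow (norm_nonneg _), ofReal_norm]
  have hw' : ∫⁻ s in Icc a b, ‖(WithLp.toLp 2 (u s j).w : EuclideanSpace ℝ (Fin nw))‖ₑ ^ 2 =
      ENNReal.ofReal (∫ s in Icc a b,
        ‖(WithLp.toLp 2 (u s j).w : EuclideanSpace ℝ (Fin nw))‖ ^ 2) := by
    rw [ofReal_integral_eq_lintegral_ofReal hwi (.of_forall fun s => sq_nonneg _)]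
    exact lintegral_congr fun s => by
      rw [ENNReal.ofReal_pow (norm_nonneg _), ofReal_norm]
  have hVa : 0 ≤ (φ a j).energy P₁ P₂ δ := ErrState.energy_nonneg hP₁ hP₂ _
  rw [hy, hw', ← ENNReal.ofReal_pow hγ, ← ENNReal.ofReal_mul (sq_nonneg γ),
    ← ENNReal.ofReal_add (setIntegral_nonneg measurableSet_Icc fun s _ => sq_nonneg _)
      (ErrState.energy_nonneg hP₁ hP₂ _),
    ← ENNReal.ofReal_add hVa (mul_nonneg (sq_nonneg γ)
      (setIntegral_nonneg measurableSet_Icc fun s _ => sq_nonneg _))]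
  exact ENNReal.ofReal_le_ofReal (by linarith)

theorem SampledPlant.hasL2Gain (hT₁ : 0 ≤ p.T₁) (hT₂ : 0 ≤ p.T₂) (hχ : 0 < χ) (hδ : 0 < δ)
    (hγ : 0 ≤ γ)
    (hψ : ∀ v₁ v₂ : EuclideanSpace ℝ (Fin nq), ‖p.ψ v₁ - p.ψ v₂‖ ≤ p.ell * ‖v₁ - v₂‖)
    (hP₁ : P₁.PosDef) (hP₂ : P₂.PosDef) (hβ : 0 < β) (hρ₂ : 0 < ρ₂)
    (hM : ∀ τ ∈ Icc 0 p.T₂, ∀ v, v ⬝ᵥ p.matM L H P₁ P₂ δ χ γ 0 τ *ᵥ v ≤ -β * (v ⬝ᵥ v))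
    (h1 : lambdaMax P₁ ≤ ρ₂) (h2 : lambdaMax P₂ * Real.exp (δ * p.T₂) ≤ ρ₂) :
    p.HasL2Gain L H γ := by
  classical
  refine ⟨√ρ₂, Real.sqrt_pos.2 hρ₂, fun E φ u hs hη => ?_⟩
  obtain ⟨t, ht⟩ := hs.domain.exists_isSwitchingSequence
  rw [ht.setLIntegral_domTime fun s j => ‖(p.errorSystem L H).output (φ s j)‖ₑ ^ 2,
    ht.setLIntegral_domTime fun s j =>
      ‖(WithLp.toLp 2 (u s j).w : EuclideanSpace ℝ (Fin nw))‖ₑ ^ 2]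
  set Y : ℕ → ℝ≥0∞ := fun j =>
    ∫⁻ s in hybridSlice E j, ‖(p.errorSystem L H).output (φ s j)‖ₑ ^ 2
  set W : ℕ → ℝ≥0∞ := fun j =>
    ∫⁻ s in hybridSlice E j, ‖(WithLp.toLp 2 (u s j).w : EuclideanSpace ℝ (Fin nw))‖ₑ ^ 2
  -- Energy at the start of each slice, and zero beyond the last one, so that the telescoping step
  -- holds for every index.
  set V : ℕ → ℝ≥0∞ := fun j => if (hybridSlice E j).Nonempty then
    ENNReal.ofReal ((φ (t j) j).energy P₁ P₂ δ) else 0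
  have hflow : ∀ (j : ℕ) (s : ℝ), s ∈ hybridSlice E j →
      (∫⁻ s in Icc (t j) s, ‖(p.errorSystem L H).output (φ s j)‖ₑ ^ 2) +
        ENNReal.ofReal ((φ s j).energy P₁ P₂ δ) ≤ V j + ENNReal.ofReal γ ^ 2 * W j := by
    intro j s hj
    refine (hs.energy_add_lintegral_le ht hT₁ hT₂ hχ hγ hψ hP₁ hP₂ hβ hM (ht.left_le hj)
      (ht.Icc_subset hj)).trans ?_
    rw [show V j = _ from if_pos ⟨s, hj⟩]
    gcongr
    exact lintegral_mono_set (ht.Icc_subset hj)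
  have hstep : ∀ j, Y j + V (j + 1) ≤ V j + ENNReal.ofReal γ ^ 2 * W j := by
    intro j
    by_cases hj' : (hybridSlice E (j + 1)).Nonempty
    · have hr := ht.right_mem hj'
      have hYj : Y j = ∫⁻ s in Icc (t j) (t (j + 1)),
          ‖(p.errorSystem L H).output (φ s j)‖ₑ ^ 2 := by
        rw [← ht.eq_Icc j _ (Nat.lt_succ_self j) hj']
      rw [hYj, show V (j + 1) = _ from if_pos hj']
      refine le_trans ?_ (hflow j _ hr)
      gcongr
      have := hs.energy_jump_le (P₁ := P₁) hδ hP₂ hr (ht.left_mem hj')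
      rw [hη _ hr] at this
      simpa using this
    · rw [show V (j + 1) = _ from if_neg hj', add_zero]
      exact ht.setLIntegral_le fun s hsj => le_self_add.trans (hflow j s hsj)
  have hsum : ∀ n, ∑ j ∈ Finset.range n, Y j + V n ≤
      V 0 + ENNReal.ofReal γ ^ 2 * ∑ j ∈ Finset.range n, W j := by
    intro n
    induction n with
    | zero => simp
    | succ n ih =>
      rw [Finset.sum_range_succ, Finset.sum_range_succ, mul_add, add_assoc, ← add_assoc (V 0)]
      calc ∑ j ∈ Finset.range n, Y j + (Y n + V (n + 1))
          ≤ ∑ j ∈ Finset.range n, Y j + (V n + ENNReal.ofReal γ ^ 2 * W n) := by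
            exact add_le_add le_rfl (hstep n)
        _ = ∑ j ∈ Finset.range n, Y j + V n + ENNReal.ofReal γ ^ 2 * W n := by rw [add_assoc]
        _ ≤ _ := by gcongr
  have hV0 : V 0 ≤ ENNReal.ofReal (√ρ₂ * Metric.infDist (φ 0 0) p.attractor) ^ 2 := by
    by_cases h0 : (hybridSlice E 0).Nonempty
    · rw [show V 0 = _ from if_pos h0, ← ENNReal.ofReal_pow (mul_nonneg (Real.sqrt_nonneg _)
        Metric.infDist_nonneg), mul_pow, Real.sq_sqrt hρ₂.le, ht.zero]
      have hE : ((0 : ℝ), 0) ∈ E := by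
        have := ht.left_mem h0
        rwa [ht.zero] at this
      have hτ := hs.τ_mem ht hT₁ hT₂ hE
      rw [p.infDist_attractor_sq hτ]
      exact ENNReal.ofReal_le_ofReal (ErrState.energy_le hδ hP₁ hP₂ hτ.2 h1 h2)
    · rw [show V 0 = _ from if_neg h0]
      exact zero_le
  have htot : ∑' j, Y j ≤ ENNReal.ofReal (√ρ₂ * Metric.infDist (φ 0 0) p.attractor) ^ 2 +
      ENNReal.ofReal γ ^ 2 * ∑' j, W j := by
    refine ENNReal.tsum_le_of_sum_range_le fun n => le_self_add.trans ((hsum n).trans ?_)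
    gcongr
    exact ENNReal.sum_le_tsum _
  have hsqrt : ∀ x : ℝ≥0∞, (x ^ 2) ^ (1 / 2 : ℝ) = x := fun x => by
    rw [← ENNReal.rpow_natCast, ← ENNReal.rpow_mul]
    norm_num
  -- Subadditivity of the square root splits the initial energy from the input term.
  refine (ENNReal.rpow_le_rpow htot (by norm_num)).trans
    ((ENNReal.rpow_add_le_add_rpow _ _ (by norm_num) (by norm_num)).trans ?_)
  rw [hsqrt, ENNReal.mul_rpow_of_nonneg _ _ (by norm_num), hsqrt]

end Estimates

/-! ### Lipschitz continuity of the flow map. -/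

section LipschitzTools

theorem lipschitzWith_euclidean_reindex {ι κ : Type*} [Fintype ι] [Fintype κ] (σ : ι → κ) :
    LipschitzWith 1 fun (x : EuclideanSpace ℝ κ) (i : ι) => x (σ i) :=
  LipschitzWith.of_edist_le fun x y => edist_pi_le_iff.2 fun i =>
    (edist_le_pi_edist x.ofLp y.ofLp (σ i)).trans
      (by simpa using PiLp.lipschitzWith_ofLp 2 (fun _ : κ => ℝ) x y)

theorem Matrix.exists_lipschitzWith_mulVec {m n : Type*} [Fintype m] [Fintype n]
    (X : Matrix m n ℝ) : ∃ K, LipschitzWith K fun v : n → ℝ => X *ᵥ v :=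
  ⟨_, (LinearMap.toContinuousLinearMap X.mulVecLin).lipschitz⟩

theorem Matrix.exists_lipschitzWith_mulVec_comp {m n Z : Type*} [Fintype m] [Fintype n]
    [PseudoEMetricSpace Z] (X : Matrix m n ℝ) {f : Z → n → ℝ} (hf : ∃ K, LipschitzWith K f) :
    ∃ K, LipschitzWith K fun q => X *ᵥ f q := by
  obtain ⟨K, hK⟩ := X.exists_lipschitzWith_mulVec
  obtain ⟨K', hK'⟩ := hf
  exact ⟨_, hK.comp hK'⟩

theorem exists_lipschitzWith_add {Z F : Type*} [PseudoEMetricSpace Z] [SeminormedAddCommGroup F]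
    {f g : Z → F} (hf : ∃ K, LipschitzWith K f) (hg : ∃ K, LipschitzWith K g) :
    ∃ K, LipschitzWith K fun q => f q + g q :=
  ⟨_, hf.choose_spec.add hg.choose_spec⟩

theorem exists_lipschitzWith_sub {Z F : Type*} [PseudoEMetricSpace Z] [SeminormedAddCommGroup F]
    {f g : Z → F} (hf : ∃ K, LipschitzWith K f) (hg : ∃ K, LipschitzWith K g) :
    ∃ K, LipschitzWith K fun q => f q - g q :=
  ⟨_, hf.choose_spec.sub hg.choose_spec⟩

variable {nz ny nw nq ns np : ℕ} (p : SampledPlant nz ny nw nq ns np)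

theorem SampledPlant.exists_lipschitzWith_psi_comp {Z : Type*} [PseudoEMetricSpace Z]
    (hψ : ∀ v₁ v₂ : EuclideanSpace ℝ (Fin nq), ‖p.ψ v₁ - p.ψ v₂‖ ≤ p.ell * ‖v₁ - v₂‖)
    {f : Z → Fin nq → ℝ} (hf : ∃ K, LipschitzWith K f) :
    ∃ K, LipschitzWith K fun q => p.psi (f q) := by
  obtain ⟨K', hK'⟩ := hf
  have h1 : LipschitzWith p.ell.toNNReal p.ψ := LipschitzWith.of_dist_le_mul fun x y => by
    rw [dist_eq_norm, dist_eq_norm]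
    exact (hψ x y).trans (mul_le_mul_of_nonneg_right (Real.le_coe_toNNReal _) (norm_nonneg _))
  exact ⟨_, (PiLp.lipschitzWith_ofLp 2 _).comp (h1.comp ((PiLp.lipschitzWith_toLp 2 _).comp hK'))⟩

theorem ErrState.exists_lipschitzWith_mk_comp {Z : Type*} [PseudoEMetricSpace Z]
    {f : Z → Fin nz → ℝ} {g : Z → Fin nz ⊕ Fin ny → ℝ} (hf : ∃ K, LipschitzWith K f)
    (hg : ∃ K, LipschitzWith K g) (c : ℝ) :
    ∃ K, LipschitzWith K fun q => ErrState.mk (f q) (g q) c := by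
  obtain ⟨K₁, h₁⟩ := hf
  obtain ⟨K₂, h₂⟩ := hg
  have h : LipschitzWith (max K₁ K₂)
      fun q => (Sum.elim (f q) (Sum.elim (g q) fun _ : Unit => c)) := by
    intro x y
    have e₁ : edist (f x) (f y) ≤ (max K₁ K₂ : ℝ≥0) * edist x y :=
      (h₁ x y).trans (by gcongr; exact le_max_left _ _)
    have e₂ : edist (g x) (g y) ≤ (max K₁ K₂ : ℝ≥0) * edist x y :=
      (h₂ x y).trans (by gcongr; exact le_max_right _ _)
    refine edist_pi_le_iff.2 ?_
    rintro (i | i | i)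
    · exact (edist_le_pi_edist (f x) (f y) i).trans e₁
    · exact (edist_le_pi_edist (g x) (g y) i).trans e₂
    · simp
  exact ⟨_, (PiLp.lipschitzWith_toLp 2 _).comp h⟩

/-- ψ is the only nonlinearity, and it is composed with linear maps. This yields both the linear
growth and the local existence needed for completeness. -/
theorem SampledPlant.exists_lipschitzWith_flowMap
    (L : Matrix (Fin nz) (Fin ny) ℝ) (H : Matrix (Fin ny) (Fin ny) ℝ)
    (hψ : ∀ v₁ v₂ : EuclideanSpace ℝ (Fin nq), ‖p.ψ v₁ - p.ψ v₂‖ ≤ p.ell * ‖v₁ - v₂‖) :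
    ∃ K, LipschitzWith K fun q : ErrState nz ny × ErrInput nw ny =>
      (p.errorSystem L H).flowMap q.1 q.2 := by
  have hz : ∃ K, LipschitzWith K fun q : ErrState nz ny × ErrInput nw ny => q.1.z :=
    ⟨_, (lipschitzWith_euclidean_reindex _).comp LipschitzWith.prod_fst⟩
  have he : ∃ K, LipschitzWith K fun q : ErrState nz ny × ErrInput nw ny => q.1.err :=
    ⟨_, (lipschitzWith_euclidean_reindex _).comp LipschitzWith.prod_fst⟩
  have hε : ∃ K, LipschitzWith K fun q : ErrState nz ny × ErrInput nw ny => q.1.ε :=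
    ⟨_, (lipschitzWith_euclidean_reindex fun i => Sum.inr (Sum.inl (Sum.inl i))).comp
      LipschitzWith.prod_fst⟩
  have hw : ∃ K, LipschitzWith K fun q : ErrState nz ny × ErrInput nw ny => q.2.w :=
    ⟨_, (lipschitzWith_euclidean_reindex _).comp LipschitzWith.prod_snd⟩
  refine ErrState.exists_lipschitzWith_mk_comp ?_ ?_ _
  · exact exists_lipschitzWith_add (exists_lipschitzWith_add
      (p.A.exists_lipschitzWith_mulVec_comp hz) (p.B.exists_lipschitzWith_mulVec_comp
        (p.exists_lipschitzWith_psi_comp hψ (p.S.exists_lipschitzWith_mulVec_comp hz))))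
      (p.N.exists_lipschitzWith_mulVec_comp hw)
  · refine exists_lipschitzWith_add (exists_lipschitzWith_add
      ((p.matF L H).exists_lipschitzWith_mulVec_comp he) (p.matQ.exists_lipschitzWith_mulVec_comp
        (exists_lipschitzWith_sub ?_ ?_))) (p.matT.exists_lipschitzWith_mulVec_comp hw)
    · exact p.exists_lipschitzWith_psi_comp hψ (p.S.exists_lipschitzWith_mulVec_comp hz)
    · exact p.exists_lipschitzWith_psi_comp hψ (p.S.exists_lipschitzWith_mulVec_comp
        (exists_lipschitzWith_sub hz hε))

end LipschitzTools

/-! ### Local existence and gluing of curves. -/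

section Extension

/-- Local existence for an autonomous differential equation with Lipschitz right-hand side. -/
theorem LipschitzWith.exists_local_solution {X : Type*} [NormedAddCommGroup X] [NormedSpace ℝ X]
    [CompleteSpace X] {F : X → X} {K : ℝ≥0} (hF : LipschitzWith K F) (x₀ : X) (T : ℝ) :
    ∃ h : ℝ, 0 < h ∧ ∃ (f : ℝ → X) (C : ℝ≥0), f T = x₀ ∧
      (∀ s ∈ Ioo T (T + h), HasDerivAt f (F (f s)) s) ∧ LipschitzOnWith C f (Icc T (T + h)) := by
  -- M bounds the field on the unit ball around `x₀`, and h = 1/(M + 1) gives M h ≤ 1, so the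
  -- solution stays in that ball.
  set M : ℝ≥0 := ‖F x₀‖₊ + K with hM
  set h : ℝ := 1 / (M + 1) with hh
  have h0 : 0 < h := by positivity
  have hmem : T ∈ Icc T (T + h) := ⟨le_rfl, by linarith⟩
  have hbound : ∀ x ∈ Metric.closedBall x₀ (1 : ℝ≥0), ‖F x‖ ≤ M := by
    intro x hx
    have h1 := hF.dist_le_mul x x₀
    have h2 : dist x x₀ ≤ 1 := by simpa using hx
    have h3 : ‖F x‖ ≤ ‖F x₀‖ + dist (F x) (F x₀) := by
      rw [dist_eq_norm]
      exact norm_le_norm_add_norm_sub' _ _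
    have h4 : (K : ℝ) * dist x x₀ ≤ K := mul_le_of_le_one_right K.2 h2
    rw [hM]
    push_cast
    linarith
  have hPL : IsPicardLindelof (fun _ => F) (⟨T, hmem⟩ : Icc T (T + h)) x₀ 1 0 M K := by
    refine IsPicardLindelof.of_time_independent hbound hF.lipschitzOnWith ?_
    have : (M : ℝ) * h ≤ 1 := by
      rw [hh, mul_one_div, div_le_one (by positivity)]
      linarith
    simpa [h0.le] using this
  obtain ⟨f, hf0, hf⟩ := hPL.exists_eq_forall_mem_Icc_hasDerivWithinAt₀
  have hcont : ContinuousOn f (Icc T (T + h)) := fun s hs => (hf s hs).continuousWithinAt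
  obtain ⟨C, hC⟩ := isCompact_Icc.exists_bound_of_continuousOn
    (hF.continuous.comp_continuousOn hcont)
  refine ⟨h, h0, f, C.toNNReal, hf0, fun s hs => (hf s (Ioo_subset_Icc_self hs)).hasDerivAt
    (Icc_mem_nhds hs.1 hs.2), ?_⟩
  refine (convex_Icc T (T + h)).lipschitzOnWith_of_nnnorm_hasDerivWithin_le hf fun s hs => ?_
  rw [← NNReal.coe_le_coe, coe_nnnorm]
  exact (hC s hs).trans (Real.le_coe_toNNReal _)

/-- Truncation at `T` keeps disjoint intervals disjoint and does not lengthen them. -/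
theorem AbsolutelyContinuousOnInterval.comp_min {X : Type*} [PseudoMetricSpace X] {f : ℝ → X}
    {a b T : ℝ} (haT : a ≤ T) (hf : AbsolutelyContinuousOnInterval f a T) (hab : T ≤ b) :
    AbsolutelyContinuousOnInterval (fun s => f (min s T)) a b := by
  rw [absolutelyContinuousOnInterval_iff] at hf ⊢
  intro ε hε
  obtain ⟨δ, hδ, hfδ⟩ := hf ε hε
  refine ⟨δ, hδ, fun E hE hEδ => ?_⟩
  refine hfδ (E.1, fun i => (min (E.2 i).1 T, min (E.2 i).2 T)) ⟨fun i hi => ?_, ?_⟩ ?_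
  · have := hE.1 i hi
    rw [uIcc_of_le (haT.trans hab)] at this
    rw [uIcc_of_le haT]
    exact ⟨⟨le_min this.1.1 haT, min_le_right _ _⟩, ⟨le_min this.2.1 haT, min_le_right _ _⟩⟩
  · refine hE.2.mono_on fun i _ => ?_
    intro z hz
    simp only [mem_uIoc, le_min_iff, min_lt_iff] at hz ⊢
    grind
  · refine lt_of_le_of_lt (Finset.sum_le_sum fun i _ => ?_) hEδ
    simp only [Real.dist_eq]
    exact abs_inf_sub_inf_le_abs _ _ _

theorem AbsolutelyContinuousOnInterval.glue {X : Type*} [NormedAddCommGroup X]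
    {f g : ℝ → X} {a b T : ℝ} {C : ℝ≥0} (haT : a ≤ T) (hTb : T ≤ b)
    (hf : AbsolutelyContinuousOnInterval f a T) (hg : LipschitzOnWith C g (Icc T b))
    (hfg : f T = g T) :
    AbsolutelyContinuousOnInterval (fun s => if s ≤ T then f s else g s) a b := by
  have hg' : LipschitzOnWith C (fun s => g (max s T)) (uIcc a b) := by
    have h1 : LipschitzWith 1 fun s : ℝ => max s T := LipschitzWith.id.max_const T
    have h2 := hg.comp h1.lipschitzOnWith (s := uIcc a b) (fun s hs => by
      rw [uIcc_of_le (haT.trans hTb)] at hs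
      exact ⟨le_max_right _ _, max_le hs.2 hTb⟩)
    rwa [mul_one] at h2
  have hc : AbsolutelyContinuousOnInterval (fun _ : ℝ => g T) a b :=
    (LipschitzWith.const (g T)).lipschitzOnWith.absolutelyContinuousOnInterval
  refine ((hf.comp_min haT hTb).fun_add (hg'.absolutelyContinuousOnInterval.fun_sub hc)).congr
    fun s _ => ?_
  -- The glued curve is f(min s T) + (g(max s T) - g T).
  by_cases hs : s ≤ T
  · simp [hs]
  · have hs' : T ≤ s := (not_le.1 hs).le
    simp [hs, hs', hfg]

end Extension

/-! ### Continuing solutions by flow or by a jump. -/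

section Maximal

/-- A locally absolutely continuous curve on `[a, T)` whose derivative grows at most linearly
extends to a Lipschitz curve. -/
theorem exists_lipschitz_extension_of_linear_growth {ι : Type*} [Fintype ι]
    {f : ℝ → EuclideanSpace ℝ ι} {a T K C : ℝ} (hK : 0 ≤ K) (hC : 0 ≤ C)
    (hac : ∀ b ∈ Ico a T, AbsolutelyContinuousOnInterval f a b)
    (hf : ∀ᵐ s : ℝ, s ∈ Ioo a T → ∃ f', ‖f'‖ ≤ K * ‖f s‖ + C ∧ HasDerivAt f f' s) :
    ∃ (M : ℝ≥0) (g : ℝ → EuclideanSpace ℝ ι), LipschitzWith M g ∧ EqOn f g (Ico a T) := by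
  -- From 2|f|(K|f| + C) ≤ (2K + 1)|f|² + C², which bounds the derivative of |f|².
  set c := 2 * K + 1 with hc
  have hc0 : 0 < c := by positivity
  set R := Real.exp (c * (T - a)) * (‖f a‖ ^ 2 + C ^ 2 / c) with hR
  have hbound : ∀ b ∈ Ico a T, ‖f b‖ ≤ √R := by
    intro b hb
    have hn : AbsolutelyContinuousOnInterval (fun s => ‖f s‖) a b :=
      lipschitzWith_one_norm.comp_absolutelyContinuousOnInterval (hac b hb)
    have hsq : AbsolutelyContinuousOnInterval (fun s => ‖f s‖ ^ 2) a b := by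
      simpa only [pow_two] using hn.fun_mul hn
    have h1 := hsq.le_exp_mul (c := -c) (G := -(C ^ 2 / c)) hb.1 (by
      filter_upwards [hf] with s hs hm
      obtain ⟨f', hf', hd⟩ := hs ⟨hm.1, hm.2.trans hb.2⟩
      refine ⟨_, ?_, hd.norm_sq⟩
      have h2 := real_inner_le_norm (f s) f'
      have h3 := mul_le_mul_of_nonneg_left hf' (norm_nonneg (f s))
      have h4 : -(-c) * (‖f s‖ ^ 2 - -(C ^ 2 / c)) = c * ‖f s‖ ^ 2 + C ^ 2 := by
        field_simp
        ring
      rw [h4, hc]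
      nlinarith [sq_nonneg (‖f s‖ - C)])
    rw [sub_neg_eq_add, sub_neg_eq_add, neg_neg] at h1
    have h5 : Real.exp (c * (b - a)) * (‖f a‖ ^ 2 + C ^ 2 / c) ≤ R := by
      rw [hR]
      gcongr
      exact hb.2.le
    have h6 : 0 ≤ C ^ 2 / c := by positivity
    exact Real.le_sqrt_of_sq_le (by linarith)
  set M := K * √R + C with hM
  have hM0 : 0 ≤ M := by positivity
  have hcoord : ∀ i, LipschitzOnWith M.toNNReal (fun s => f s i) (Ico a T) := by
    intro i
    refine LipschitzOnWith.of_le_add_mul' M fun x hx y hy => ?_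
    have key : ∀ x ∈ Ico a T, ∀ y ∈ Ico a T, x ≤ y → |f y i - f x i| ≤ M * (y - x) := by
      intro x hx y hy hxy
      have hi : AbsolutelyContinuousOnInterval (fun s => f s i) x y :=
        ((EuclideanSpace.proj i : EuclideanSpace ℝ ι →L[ℝ] ℝ).lipschitz.comp_absolutelyContinuousOnInterval
          (hac y hy)).mono (by
            rw [uIcc_of_le hxy, uIcc_of_le hy.1]
            exact Icc_subset_Icc_left hx.1)
      have hder : ∀ᵐ s : ℝ, s ∈ Ioo x y → ∃ d, |d| ≤ M ∧ HasDerivAt (fun s => f s i) d s := by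
        filter_upwards [hf] with s hs hm
        have hsI : s ∈ Ioo a T := ⟨hx.1.trans_lt hm.1, hm.2.trans hy.2⟩
        obtain ⟨f', hf', hd⟩ := hs hsI
        refine ⟨f' i, ?_, (EuclideanSpace.proj i :
          EuclideanSpace ℝ ι →L[ℝ] ℝ).hasFDerivAt.comp_hasDerivAt s hd⟩
        have h1 : ‖f' i‖ ≤ ‖f'‖ := PiLp.norm_apply_le f' i
        have h2 := mul_le_mul_of_nonneg_left (hbound s ⟨hsI.1.le, hsI.2⟩) hK
        rw [Real.norm_eq_abs] at h1
        linarith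
      have h1 := hi.sub_le_integral (g := fun _ => M) hxy intervalIntegrable_const (by
        filter_upwards [hder] with s hs hm
        obtain ⟨d, hd, hd'⟩ := hs hm
        exact ⟨d, (le_abs_self d).trans hd, hd'⟩)
      have h2 := hi.fun_neg.sub_le_integral (g := fun _ => M) hxy intervalIntegrable_const (by
        filter_upwards [hder] with s hs hm
        obtain ⟨d, hd, hd'⟩ := hs hm
        exact ⟨-d, (neg_le_abs d).trans hd, hd'.neg⟩)
      simp only [intervalIntegral.integral_const, smul_eq_mul] at h1 h2
      rw [abs_le]
      constructor <;> linarith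
    rw [Real.dist_eq]
    rcases le_total x y with h | h
    · have h1 := abs_le.1 (key x hx y hy h)
      have h2 : |x - y| = y - x := by rw [abs_sub_comm, abs_of_nonneg (sub_nonneg.2 h)]
      rw [h2]
      linarith [h1.1]
    · have h1 := abs_le.1 (key y hy x hx h)
      rw [abs_of_nonneg (sub_nonneg.2 h)]
      linarith [h1.2]
  -- Each coordinate is extended as a real Lipschitz function with the same constant.
  choose g hg hfg using fun i => (hcoord i).extend_real
  have hpi : LipschitzWith M.toNNReal fun s i => g i s := fun x y =>
    edist_pi_le_iff.2 fun i => hg i x y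
  refine ⟨_, fun s => WithLp.toLp 2 fun i => g i s, (PiLp.lipschitzWith_toLp 2 _).comp hpi,
    fun s hs => ?_⟩
  ext i
  exact hfg i hs

section Extend

variable {X U Y : Type*} [NormedAddCommGroup X] [NormedSpace ℝ X] [NormedAddCommGroup U]
  {S : HybridSystem X U Y} {E : Set (ℝ × ℕ)} {φ : ℝ → ℕ → X} {u : ℝ → ℕ → U} {t : ℕ → ℝ}

open Classical in
theorem IsHybridInput.extend_zero (hu : IsHybridInput E u) (ht : IsSwitchingSequence E t)
    (E' : Set (ℝ × ℕ)) : IsHybridInput E' (fun s j => if (s, j) ∈ E then u s j else 0) := by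
  intro j
  obtain ⟨h1, h2⟩ := hu j
  have hind : (fun s => if (s, j) ∈ E then u s j else 0) =
      (hybridSlice E j).indicator fun s => u s j := by
    ext s
    by_cases h : (s, j) ∈ E <;> simp [indicator, hybridSlice, h]
  refine ⟨?_, fun T => ?_⟩
  · rw [hind]
    exact ((aestronglyMeasurable_indicator_iff (ht.measurableSet_slice j)).2 h1).restrict
  · obtain ⟨K, hK⟩ := h2 T
    refine ⟨max K 0, ae_restrict_of_ae_restrict_of_subset inter_subset_right ?_⟩
    rw [ae_restrict_iff' ((ht.measurableSet_slice j).inter measurableSet_Iic)] at hK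
    rw [ae_restrict_iff' measurableSet_Iic]
    filter_upwards [hK] with s hs hsT
    by_cases h : (s, j) ∈ E
    · rw [if_pos h]
      exact (hs ⟨h, hsT⟩).trans (le_max_left _ _)
    · simp [h]

open Classical in
/-- A maximal solution pair contains the right end of each of its continuations by flow. -/
theorem IsMaximalSolutionPair.mem_of_flow (hmax : IsMaximalSolutionPair S E φ u)
    (ht : IsSwitchingSequence E t) {J : ℕ} (hne : (hybridSlice E J).Nonempty)
    (hlast : hybridSlice E (J + 1) = ∅) {T b : ℝ} (hTt : t J ≤ T)
    (hI : Ico (t J) T ⊆ hybridSlice E J)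
    (hI' : hybridSlice E J ⊆ Icc (t J) T) (hTb : T ≤ b)
    (hdom : IsHybridTimeDomain {q : ℝ × ℕ | (q.2 = J ∧ q.1 ∈ Icc (t J) b) ∨ (q.2 ≠ J ∧ q ∈ E)})
    {f : ℝ → X} (hf : AbsolutelyContinuousOnInterval f (t J) b)
    (hfφ : ∀ s ∈ hybridSlice E J, f s = φ s J)
    (hflow : ∀ᵐ s : ℝ, s ∈ Ioo T b → f s ∈ S.flowSet ∧ HasDerivAt f (S.flowMap (f s) 0) s) :
    (b, J) ∈ E := by
  obtain ⟨hs, hmax⟩ := hmax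
  set E' := {q : ℝ × ℕ | (q.2 = J ∧ q.1 ∈ Icc (t J) b) ∨ (q.2 ≠ J ∧ q ∈ E)} with hE'
  have hsJ : hybridSlice E' J = Icc (t J) b := by
    ext s; simp [hybridSlice, hE']
  have hsj : ∀ j, j ≠ J → hybridSlice E' j = hybridSlice E j := by
    intro j hj
    ext s; simp [hybridSlice, hE', hj]
  have hsub : E ⊆ E' := by
    rintro ⟨s, j⟩ hsE
    by_cases hj : j = J
    · subst hj
      exact Or.inl ⟨rfl, Icc_subset_Icc_right hTb (hI' hsE)⟩
    · exact Or.inr ⟨hj, hsE⟩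
  set φ' : ℝ → ℕ → X := fun s j => if j = J then f s else φ s j with hφ'
  set u' : ℝ → ℕ → U := fun s j => if (s, j) ∈ E then u s j else 0 with hu'
  have hφE : ∀ s j, (s, j) ∈ E → φ' s j = φ s j := by
    intro s j hsE
    by_cases hj : j = J
    · subst hj
      simp only [hφ', if_true]
      exact hfφ s hsE
    · simp [hφ', hj]
  have huE : ∀ s j, (s, j) ∈ E → u' s j = u s j := fun s j hsE => by simp [hu', hsE]
  have hsol : IsSolutionPair S E' φ' u' := by
    refine ⟨hdom, ?_, hs.input.extend_zero ht E', ?_, ?_, ?_⟩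
    · intro j a' b' hab hj'
      by_cases hj : j = J
      · subst hj
        rw [hsJ] at hj'
        simp only [hφ', if_true]
        refine hf.mono ?_
        rw [uIcc_of_le hab, uIcc_of_le (hTt.trans hTb)]
        exact hj'
      · rw [hsj j hj] at hj'
        simpa [hφ', hj] using hs.arc j a' b' hab hj'
    · rw [hφE 0 0 (ht.zero_mem hne.some_mem)]
      exact hs.initial
    · intro j
      by_cases hj : j = J
      · subst hj
        -- Discarding these three points avoids one-sided derivatives at the ends and at the
        -- junction.
        have hne' : ∀ᵐ s : ℝ, s ∉ ({t j, T, b} : Set ℝ) :=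
          ((finite_singleton b).insert T |>.insert (t j)).countable.ae_notMem volume
        filter_upwards [hs.flow j, hflow, hne'] with s h1 h2 h3 h4
        simp only [mem_insert_iff, mem_singleton_iff, not_or] at h3
        have h4' : s ∈ hybridSlice E' j := h4
        rw [hsJ] at h4'
        simp only [hφ', if_true]
        rcases lt_or_gt_of_ne h3.2.1 with h | h
        · have hm : s ∈ Ioo (t j) T := ⟨lt_of_le_of_ne h4'.1 (Ne.symm h3.1), h⟩
          have hsE : (s, j) ∈ E := hI (Ioo_subset_Ico_self hm)
          obtain ⟨h5, h6⟩ := h1 hsE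
          have hnhds : hybridSlice E j ∈ nhds s :=
            Filter.mem_of_superset (Ioo_mem_nhds hm.1 hm.2) (Ioo_subset_Ico_self.trans hI)
          rw [huE s j hsE, hfφ s hsE]
          refine ⟨h5, ((h6.hasDerivAt hnhds).congr_of_eventuallyEq ?_).hasDerivWithinAt⟩
          filter_upwards [hnhds] with r hr using hfφ r hr
        · have hsE : (s, j) ∉ E := fun hc => absurd (hI' hc).2 (not_le.2 h)
          obtain ⟨h5, h6⟩ := h2 ⟨h, lt_of_le_of_ne h4'.2 h3.2.2⟩
          rw [show u' s j = 0 from if_neg hsE]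
          exact ⟨h5, h6.hasDerivWithinAt⟩
      · filter_upwards [hs.flow j] with s h1 h2
        have hsE : (s, j) ∈ E := by
          have : s ∈ hybridSlice E' j := h2
          rwa [hsj j hj] at this
        rw [huE s j hsE, hφE s j hsE, hsj j hj]
        simpa [hφ', hj] using h1 hsE
    · intro s j h1 h2
      have hj : j ≠ J := by
        rintro rfl
        rcases h2 with ⟨h2, -⟩ | ⟨-, h2⟩
        · exact absurd h2 (Nat.succ_ne_self _)
        · exact notMem_empty s (hlast ▸ (show s ∈ hybridSlice E (j + 1) from h2))
      have h1E : (s, j) ∈ E := by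
        have : s ∈ hybridSlice E' j := h1
        rwa [hsj j hj] at this
      have h2E : (s, j + 1) ∈ E := by
        have h3 : s ∈ hybridSlice E' (j + 1) := h2
        -- Although slice `J` has been enlarged, it meets the preceding slice only at `t J`, which
        -- was already in the domain.
        by_cases hj' : j + 1 = J
        · subst hj'
          rw [hsJ] at h3
          have h4 : s ∈ hybridSlice E j := h1E
          rw [ht.eq_Icc j _ (Nat.lt_succ_self j) hne] at h4
          rw [le_antisymm h4.2 h3.1]
          exact ht.left_mem hne
        · rwa [hsj _ hj'] at h3
      rw [hφE s j h1E, hφE s _ h2E, huE s j h1E]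
      exact hs.jump s j h1E h2E
  have := hmax E' φ' u' hsol hsub fun q hq => ⟨hφE q.1 q.2 hq, huE q.1 q.2 hq⟩
  rw [← this]
  exact Or.inl ⟨rfl, hTt.trans hTb, le_rfl⟩

open Classical in
/-- A maximal solution pair contains each of its continuations by a jump. -/
theorem IsMaximalSolutionPair.mem_of_jump (hmax : IsMaximalSolutionPair S E φ u)
    (ht : IsSwitchingSequence E t) {J : ℕ} {T : ℝ} (hT : (T, J) ∈ E)
    (hlast : hybridSlice E (J + 1) = ∅)
    (hdom : IsHybridTimeDomain {q : ℝ × ℕ | (q.2 = J + 1 ∧ q.1 = T) ∨ q ∈ E})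
    (hjump : φ T J ∈ S.jumpSet) {g : X} (hg : g ∈ S.jumpMap (φ T J) (u T J)) :
    (T, J + 1) ∈ E := by
  obtain ⟨hs, hmax⟩ := hmax
  set E' := {q : ℝ × ℕ | (q.2 = J + 1 ∧ q.1 = T) ∨ q ∈ E} with hE'
  have hlast' : ∀ s, (s, J + 1) ∉ E := fun s h =>
    notMem_empty s (hlast ▸ (show s ∈ hybridSlice E (J + 1) from h))
  have hmemE : ∀ s j, j ≠ J + 1 → (s, j) ∈ E' → (s, j) ∈ E := by
    rintro s j hj (⟨h, -⟩ | h)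
    · exact absurd h hj
    · exact h
  have hsj : ∀ j, j ≠ J + 1 → hybridSlice E' j = hybridSlice E j := by
    intro j hj
    ext s; simp [hybridSlice, hE', hj]
  have hlastT : ∀ s, (s, J + 1) ∈ E' → s = T := by
    rintro s (⟨-, h⟩ | h)
    · exact h
    · exact absurd h (hlast' s)
  set φ' : ℝ → ℕ → X := fun s j => if j = J + 1 then g else φ s j with hφ'
  set u' : ℝ → ℕ → U := fun s j => if (s, j) ∈ E then u s j else 0 with hu'
  have hφj : ∀ s j, j ≠ J + 1 → φ' s j = φ s j := fun s j hj => by simp [hφ', hj]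
  have hφE : ∀ s j, (s, j) ∈ E → φ' s j = φ s j := by
    intro s j hsE
    refine hφj s j ?_
    rintro rfl
    exact hlast' s hsE
  have huE : ∀ s j, (s, j) ∈ E → u' s j = u s j := fun s j hsE => by simp [hu', hsE]
  have hsol : IsSolutionPair S E' φ' u' := by
    refine ⟨hdom, ?_, hs.input.extend_zero ht E', ?_, ?_, ?_⟩
    · intro j a' b' hab hj'
      by_cases hj : j = J + 1
      · subst hj
        simp only [hφ', if_true]
        exact (LipschitzWith.const g).lipschitzOnWith.absolutelyContinuousOnInterval
      · rw [hsj j hj] at hj'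
        simpa [hφ', hj] using hs.arc j a' b' hab hj'
    · rw [hφE 0 0 (ht.zero_mem hT)]
      exact hs.initial
    · intro j
      by_cases hj : j = J + 1
      · subst hj
        -- The new slice is a single point, so the flow condition on it is void.
        filter_upwards [(countable_singleton T).ae_notMem volume] with s h1 h2
        exact absurd (hlastT s h2) h1
      · filter_upwards [hs.flow j] with s h1 h2
        have hsE := hmemE s j hj h2
        rw [huE s j hsE, hφE s j hsE, hsj j hj]
        simpa [hφ', hj] using h1 hsE
    · intro s j h1 h2
      have hj : j ≠ J + 1 := by
        rintro rfl
        have h3 := hmemE s _ (Nat.succ_ne_self _) h2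
        obtain ⟨r, hr⟩ := ht.nonempty_of_lt (Nat.lt_succ_self (J + 1)) ⟨s, h3⟩
        exact hlast' r hr
      have h1E := hmemE s j hj h1
      rw [hφE s j h1E, huE s j h1E]
      by_cases hj' : j = J
      · subst hj'
        rw [hlastT s h2]
        refine ⟨hjump, ?_⟩
        simpa [hφ'] using hg
      · have h2E := hmemE s (j + 1) (fun h => hj' (Nat.succ_injective h)) h2
        rw [hφE s _ h2E]
        exact hs.jump s j h1E h2E
  have := hmax E' φ' u' hsol (fun q hq => Or.inr hq)
    fun q hq => ⟨hφE q.1 q.2 hq, huE q.1 q.2 hq⟩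
  rw [← this]
  exact Or.inl ⟨rfl, rfl⟩

end Extend

end Maximal

/-! ### Completeness of maximal solutions. -/

section Complete

theorem isHybridTimeDomain_hybridDomainUpTo {t : ℕ → ℝ} (h0 : t 0 = 0) (hm : Monotone t) {J : ℕ}
    {I : Set ℝ} (hI : (∃ T, t J ≤ T ∧ I = Icc (t J) T) ∨ (∃ T, t J < T ∧ I = Ico (t J) T) ∨
      I = Ici (t J)) : IsHybridTimeDomain (hybridDomainUpTo t J I) :=
  ⟨t, h0, hm, Or.inr ⟨J, I, hI, rfl⟩⟩

theorem isHybridTimeDomain_extend_flow {t : ℕ → ℝ} (h0 : t 0 = 0) (hm : Monotone t) {J : ℕ}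
    (I : Set ℝ) {b : ℝ} (hb : t J ≤ b) :
    IsHybridTimeDomain {q : ℝ × ℕ | (q.2 = J ∧ q.1 ∈ Icc (t J) b) ∨
      (q.2 ≠ J ∧ q ∈ hybridDomainUpTo t J I)} := by
  convert isHybridTimeDomain_hybridDomainUpTo h0 hm (Or.inl ⟨b, hb, rfl⟩) using 1
  ext ⟨s, j⟩
  simp only [hybridDomainUpTo, mem_ofPred_eq]
  by_cases hj : j = J <;> simp [hj]

theorem isHybridTimeDomain_extend_jump {t : ℕ → ℝ} (h0 : t 0 = 0) (hm : Monotone t) {J : ℕ}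
    {T : ℝ} (hT : t J ≤ T) :
    IsHybridTimeDomain {q : ℝ × ℕ | (q.2 = J + 1 ∧ q.1 = T) ∨
      q ∈ hybridDomainUpTo t J (Icc (t J) T)} := by
  -- Values of `t` beyond `J` are arbitrary, so they are reset to the time of the new jump.
  set t' : ℕ → ℝ := fun n => if n ≤ J then t n else T with ht'
  have hm' : Monotone t' := by
    intro m n hmn
    simp only [ht']
    split_ifs with h1 h2 h2
    · exact hm hmn
    · exact (hm h1).trans hT
    · omega
    · exact le_rfl
  have hJ : t' (J + 1) = T := by simp [ht']
  convert isHybridTimeDomain_hybridDomainUpTo (t := t') (J := J + 1) (by simpa [ht'] using h0) hm'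
    (Or.inl ⟨T, hJ.le, rfl⟩) using 1
  ext ⟨s, j⟩
  simp only [hybridDomainUpTo, mem_ofPred_eq, hJ, Icc_self, mem_singleton_iff]
  rcases lt_trichotomy j J with h | rfl | h
  · have h1 : j ≤ J := h.le
    have h2 : j + 1 ≤ J := h
    have h3 : j < J + 1 := by omega
    have h4 : j ≠ J + 1 := by omega
    simp [ht', h, h1, h2, h3, h4, h.ne]
  · simp [ht']
  · have h1 : ¬ j < J := by omega
    have h2 : ¬ j = J := by omega
    have h3 : ¬ j < J + 1 := by omega
    simp [h1, h2, h3]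

theorem not_isBounded_of_unbounded_time {E : Set (ℝ × ℕ)} {J : ℕ} {a : ℝ}
    (h : ∀ s, a ≤ s → (s, J) ∈ E) : ¬ Bornology.IsBounded E := by
  intro hb
  obtain ⟨C, hC⟩ := hb.subset_closedBall (0, 0)
  have h1 := hC (h (max a (C + 1)) (le_max_left _ _))
  rw [Metric.mem_closedBall, Prod.dist_eq] at h1
  have h2 := (le_max_left _ _).trans h1
  simp only [Real.dist_eq, sub_zero] at h2
  linarith [le_abs_self (max a (C + 1)), le_max_right a (C + 1)]

theorem not_isBounded_of_unbounded_jumps {E : Set (ℝ × ℕ)} {t : ℕ → ℝ}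
    (h : ∀ j, (t j, j) ∈ E) : ¬ Bornology.IsBounded E := by
  intro hb
  obtain ⟨C, hC⟩ := hb.subset_closedBall (0, 0)
  obtain ⟨n, hn⟩ := exists_nat_gt C
  have h1 := hC (h n)
  rw [Metric.mem_closedBall, Prod.dist_eq] at h1
  have h2 := (le_max_right _ _).trans h1
  simp only [Nat.dist_eq, Nat.cast_zero, sub_zero] at h2
  linarith [le_abs_self (n : ℝ)]

variable {nz ny nw nq ns np : ℕ} {p : SampledPlant nz ny nw nq ns np}
  {L : Matrix (Fin nz) (Fin ny) ℝ} {H : Matrix (Fin ny) (Fin ny) ℝ}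
  {φ : ℝ → ℕ → ErrState nz ny} {u : ℝ → ℕ → ErrInput nw ny}

/-- A maximal solution pair does not end with a half-open bounded interval. -/
theorem SampledPlant.not_maximal_of_Ico
    (hψ : ∀ v₁ v₂ : EuclideanSpace ℝ (Fin nq), ‖p.ψ v₁ - p.ψ v₂‖ ≤ p.ell * ‖v₁ - v₂‖)
    {t : ℕ → ℝ} (h0 : t 0 = 0) (hm : Monotone t) {J : ℕ} {T : ℝ} (hT : t J < T) :
    ¬ IsMaximalSolutionPair (p.errorSystem L H) (hybridDomainUpTo t J (Ico (t J) T)) φ u := by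
  intro hmax
  have hs := hmax.1
  have ht := isSwitchingSequence_hybridDomainUpTo h0 hm (Or.inr (Or.inl ⟨T, hT, rfl⟩))
  have hJ := hybridSlice_hybridDomainUpTo_self t J (Ico (t J) T)
  have hIcc : ∀ b ∈ Ico (t J) T,
      Icc (t J) b ⊆ hybridSlice (hybridDomainUpTo t J (Ico (t J) T)) J := by
    intro b hb
    rw [hJ]
    exact Icc_subset_Ico_right hb.2
  obtain ⟨K, hK⟩ := p.exists_lipschitzWith_flowMap (nw := nw) L H hψ
  obtain ⟨C, hC⟩ := (hs.input J).2 T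
  rw [hJ, ae_restrict_iff' (measurableSet_Ico.inter measurableSet_Iic)] at hC
  -- The growth bound is |f(x, u)| ≤ K(|x| + |u|) + |f(0, 0)|, with u essentially bounded up to time
  -- `T`.
  obtain ⟨M, g, hg, hgφ⟩ := exists_lipschitz_extension_of_linear_growth (f := fun s => φ s J)
    (a := t J) (T := T) (K := K)
    (C := K * max C 0 + ‖(p.errorSystem L H).flowMap 0 (0 : ErrInput nw ny)‖) K.2
    (by positivity) (fun b hb => hs.arc J _ _ hb.1 (hIcc b hb)) (by
      filter_upwards [hs.flow J, hC] with s h1 h2 hsm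
      have hsI : s ∈ Ico (t J) T := Ioo_subset_Ico_self hsm
      have hsE : s ∈ hybridSlice (hybridDomainUpTo t J (Ico (t J) T)) J := hJ.ge hsI
      refine ⟨_, ?_, (h1 hsE).2.hasDerivAt (by
        rw [hJ]; exact Filter.mem_of_superset (Ioo_mem_nhds hsm.1 hsm.2) Ioo_subset_Ico_self)⟩
      have h3 := hK.dist_le_mul (φ s J, u s J) (0, 0)
      have h4 : dist (φ s J, u s J) ((0 : ErrState nz ny), (0 : ErrInput nw ny)) ≤
          ‖φ s J‖ + max C 0 := by
        rw [Prod.dist_eq, dist_zero_right, dist_zero_right]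
        refine max_le (le_add_of_nonneg_right (le_max_right _ _)) ?_
        exact ((h2 ⟨hsI, hsI.2.le⟩).trans (le_max_left _ _)).trans
          (le_add_of_nonneg_left (norm_nonneg _))
      have h5 := mul_le_mul_of_nonneg_left h4 K.2
      rw [dist_eq_norm] at h3
      have h6 := norm_le_norm_add_norm_sub' ((p.errorSystem L H).flowMap (φ s J) (u s J))
        ((p.errorSystem L H).flowMap 0 (0 : ErrInput nw ny))
      simp only at h3
      rw [NNReal.val_eq_coe] at h5
      linarith)
  -- With `b = T` only the endpoint is added, so no flow has to be verified beyond `T`.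
  have hmem := hmax.mem_of_flow ht (J := J) (T := T) (b := T) (f := g)
    (by rw [hJ]; exact nonempty_Ico.2 hT)
    (hybridSlice_hybridDomainUpTo_of_gt _ (Nat.lt_succ_self J)) hT.le (by rw [hJ])
    (by rw [hJ]; exact Ico_subset_Icc_self) le_rfl
    (isHybridTimeDomain_extend_flow h0 hm _ hT.le)
    hg.lipschitzOnWith.absolutelyContinuousOnInterval
    (fun s hsE => (hgφ (hJ.le hsE)).symm) (.of_forall fun s hsm => by simp at hsm)
  have : T ∈ Ico (t J) T := hJ.le hmem
  exact lt_irrefl _ this.2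

/-- A maximal solution pair does not end with a compact interval. -/
theorem SampledPlant.not_maximal_of_Icc (hT₁ : 0 ≤ p.T₁) (hT₁₂ : p.T₁ ≤ p.T₂)
    (hψ : ∀ v₁ v₂ : EuclideanSpace ℝ (Fin nq), ‖p.ψ v₁ - p.ψ v₂‖ ≤ p.ell * ‖v₁ - v₂‖)
    {t : ℕ → ℝ} (h0 : t 0 = 0) (hm : Monotone t) {J : ℕ} {T : ℝ} (hT : t J ≤ T) :
    ¬ IsMaximalSolutionPair (p.errorSystem L H) (hybridDomainUpTo t J (Icc (t J) T)) φ u := by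
  intro hmax
  have hs := hmax.1
  have ht := isSwitchingSequence_hybridDomainUpTo h0 hm (Or.inl ⟨T, hT, rfl⟩)
  have hJ := hybridSlice_hybridDomainUpTo_self t J (Icc (t J) T)
  have hlast := hybridSlice_hybridDomainUpTo_of_gt (t := t) (Icc (t J) T) (Nat.lt_succ_self J)
  have hTJ : (T, J) ∈ hybridDomainUpTo t J (Icc (t J) T) :=
    hJ.ge (right_mem_Icc.2 hT)
  have hτ := hs.τ_mem ht hT₁ (hT₁.trans hT₁₂) hTJ
  rcases hτ.1.eq_or_lt with h | hpos
  · have hmem := hmax.mem_of_jump ht hTJ hlast (isHybridTimeDomain_extend_jump h0 hm hT) h.symm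
      ⟨p.T₁, left_mem_Icc.2 hT₁₂, rfl⟩
    exact notMem_empty T (hlast.le hmem)
  · obtain ⟨K, hK⟩ := p.exists_lipschitzWith_flowMap (nw := nw) L H hψ
    have hpair : LipschitzWith 1 fun x : ErrState nz ny => (x, (0 : ErrInput nw ny)) :=
      LipschitzWith.prodMk_right 0
    have hF : LipschitzWith (K * 1)
        fun x => (p.errorSystem L H).flowMap x (0 : ErrInput nw ny) := by
      have h := hK.comp hpair
      simp only [Function.comp_def] at h
      exact h
    obtain ⟨h, hh, g, C, hgT, hg, hgL⟩ := hF.exists_local_solution (φ T J) T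
    -- Stopping no later than the timer's expiry keeps the continuation in the flow set.
    set b := T + min h (φ T J).τ with hb
    have hTb : T < b := by rw [hb]; linarith [lt_min hh hpos]
    have hbh : b ≤ T + h := by rw [hb]; linarith [min_le_left h (φ T J).τ]
    have hgτ : ∀ s ∈ Ioo T b, (g s).τ = (φ T J).τ - (s - T) := by
      intro s hsm
      have hac : AbsolutelyContinuousOnInterval (fun r => (g r).τ) T s := by
        refine ErrState.absolutelyContinuousOnInterval_apply ?_ _
        refine LipschitzOnWith.absolutelyContinuousOnInterval (K := C) (hgL.mono ?_)
        rw [uIcc_of_le hsm.1.le]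
        exact Icc_subset_Icc_right (hsm.2.le.trans hbh)
      have hd : ∀ r ∈ Ioo T s, HasDerivAt (fun r => (g r).τ) (-1) r := fun r hr =>
        (ErrState.hasDerivAt_err (hg r ⟨hr.1, hr.2.trans (hsm.2.trans_le hbh)⟩)).2.2
      have h1 := hac.sub_le_integral (g := fun _ => -1) hsm.1.le intervalIntegrable_const
        (.of_forall fun r hr => ⟨_, le_rfl, hd r hr⟩)
      have h2 := hac.fun_neg.sub_le_integral (g := fun _ => 1) hsm.1.le intervalIntegrable_const
        (.of_forall fun r hr => ⟨_, by norm_num, (hd r hr).neg⟩)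
      simp only [intervalIntegral.integral_const, smul_eq_mul, hgT] at h1 h2
      linarith
    have hmem := hmax.mem_of_flow ht (J := J) (T := T) (b := b)
      (f := fun s => if s ≤ T then φ s J else g s) ⟨T, hTJ⟩ hlast hT
      (by rw [hJ]; exact Ico_subset_Icc_self) (by rw [hJ]) hTb.le
      (isHybridTimeDomain_extend_flow h0 hm _ (hT.trans hTb.le))
      (AbsolutelyContinuousOnInterval.glue hT hTb.le (hs.arc J _ _ hT (by rw [hJ]))
        (hgL.mono (Icc_subset_Icc_right hbh)) hgT.symm)
      (fun s hsE => if_pos (hJ.le hsE).2)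
      (.of_forall fun s hsm => by
        rw [if_neg (not_le.2 hsm.1)]
        refine ⟨?_, (hg s ⟨hsm.1, hsm.2.trans_le hbh⟩).congr_of_eventuallyEq ?_⟩
        · change (g s).τ ∈ Icc 0 p.T₂
          have h1 : s < T + (φ T J).τ := hsm.2.trans_le (by
            rw [hb]; linarith [min_le_right h (φ T J).τ])
          rw [hgτ s hsm]
          constructor <;> linarith [hsm.1, hτ.2]
        · filter_upwards [Ioi_mem_nhds hsm.1] with r hr
          exact if_neg (not_le.2 hr))
    have : b ∈ Icc (t J) T := hJ.le hmem
    exact absurd this.2 (not_le.2 hTb)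

theorem SampledPlant.not_isBounded_of_isMaximalSolutionPair {E : Set (ℝ × ℕ)} (hT₁ : 0 ≤ p.T₁)
    (hT₁₂ : p.T₁ ≤ p.T₂)
    (hψ : ∀ v₁ v₂ : EuclideanSpace ℝ (Fin nq), ‖p.ψ v₁ - p.ψ v₂‖ ≤ p.ell * ‖v₁ - v₂‖)
    (hmax : IsMaximalSolutionPair (p.errorSystem L H) E φ u) : ¬ Bornology.IsBounded E := by
  obtain ⟨t, h0, hm, rfl | ⟨J, I, ⟨T, hT, rfl⟩ | ⟨T, hT, rfl⟩ | rfl, rfl⟩⟩ := hmax.1.domain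
  · exact not_isBounded_of_unbounded_jumps fun j => left_mem_Icc.2 (hm (Nat.le_succ j))
  · exact absurd hmax (p.not_maximal_of_Icc hT₁ hT₁₂ hψ h0 hm hT)
  · exact absurd hmax (p.not_maximal_of_Ico hψ h0 hm hT)
  · exact not_isBounded_of_unbounded_time (J := J) (a := t J) fun s hs => Or.inr ⟨rfl, hs⟩

end Complete

/-! ### The main theorem. -/

theorem corollary2 {nz ny nw nq ns np : ℕ} (hnz : 0 < nz) (hny : 0 < ny)
    (p : SampledPlant nz ny nw nq ns np)
    (hell : 0 < p.ell)
    (hψ : ∀ v₁ v₂ : EuclideanSpace ℝ (Fin nq), ‖p.ψ v₁ - p.ψ v₂‖ ≤ p.ell * ‖v₁ - v₂‖)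
    (hT₁ : 0 < p.T₁) (hT₁₂ : p.T₁ ≤ p.T₂)
    (γ : ℝ) (hγ : 0 < γ)
    (P₁ : Matrix (Fin nz) (Fin nz) ℝ) (hP₁ : P₁.PosDef)
    (P₂ : Matrix (Fin ny) (Fin ny) ℝ) (hP₂ : P₂.PosDef)
    (δ χ : ℝ) (hδ : 0 < δ) (hχ : 0 < χ)
    (L : Matrix (Fin nz) (Fin ny) ℝ) (H : Matrix (Fin ny) (Fin ny) ℝ)
    (hM₀ : (-(p.matM L H P₁ P₂ δ χ γ 0 0)).PosDef)
    (hMT : (-(p.matM L H P₁ P₂ δ χ γ 0 p.T₂)).PosDef) :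
    ∃ β : ℝ, 0 < β ∧
      IsGreatest ((fun τ => lambdaMax (p.matM L H P₁ P₂ δ χ γ 0 τ)) '' Set.Icc 0 p.T₂) (-β) ∧
      IsEISS (p.errorSystem L H) p.attractor ∧
      HasFlowTimeDecayRate (p.errorSystem L H) p.attractor
        (β / (2 * max (lambdaMax P₁) (lambdaMax P₂ * Real.exp (δ * p.T₂)))) ∧
      p.HasL2Gain L H γ := by
  have hT₂ : 0 < p.T₂ := hT₁.trans_le hT₁₂
  have : Nonempty (Fin nz) := ⟨⟨0, hnz⟩⟩
  have : Nonempty (Fin ny) := ⟨⟨0, hny⟩⟩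
  have hH₀ : (p.matM L H P₁ P₂ δ χ γ 0 0).IsHermitian := by simpa using hM₀.isHermitian.neg
  have hHT : (p.matM L H P₁ P₂ δ χ γ 0 p.T₂).IsHermitian := by simpa using hMT.isHermitian.neg
  have hH := SampledPlant.isHermitian_matM hδ hT₂ hH₀ hHT
  obtain ⟨τ₀, hτ₀, hgreat⟩ :=
    exists_isGreatest_lambdaMax hT₂.le (SampledPlant.continuous_matM hδ hT₂) hH
  set β := -lambdaMax (p.matM L H P₁ P₂ δ χ γ 0 τ₀) with hβdef
  have hβ : 0 < β := neg_pos.2 (SampledPlant.posDef_neg_matM hδ hT₂ hM₀ hMT hτ₀).lambdaMax_neg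
  have hM : ∀ τ ∈ Icc 0 p.T₂, ∀ v, v ⬝ᵥ p.matM L H P₁ P₂ δ χ γ 0 τ *ᵥ v ≤ -β * (v ⬝ᵥ v) := by
    intro τ hτ v
    refine ((hH τ).dotProduct_mulVec_le_lambdaMax v).trans
      (mul_le_mul_of_nonneg_right ?_ (dotProduct_self_nonneg v))
    rw [hβdef, neg_neg]
    exact hgreat.2 (mem_image_of_mem _ hτ)
  set ρ₂ := max (lambdaMax P₁) (lambdaMax P₂ * Real.exp (δ * p.T₂)) with hρ₂def
  have hρ₂ : 0 < ρ₂ := by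
    obtain ⟨v, hv, h⟩ := hP₁.isHermitian.exists_mulVec_eq_lambdaMax
    have h1 := hP₁.dotProduct_mulVec_pos hv
    rw [star_trivial, h, dotProduct_smul, smul_eq_mul] at h1
    exact (pos_of_mul_pos_left h1 (dotProduct_self_nonneg v)).trans_le (le_max_left _ _)
  have h1 : lambdaMax P₁ ≤ ρ₂ := le_max_left _ _
  have h2 : lambdaMax P₂ * Real.exp (δ * p.T₂) ≤ ρ₂ := le_max_right _ _
  have hdecay := SampledPlant.hasFlowTimeDecayRate hT₁ hT₂.le hχ hδ hψ hP₁ hP₂ hβ hρ₂ hM h1 h2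
  refine ⟨β, hβ, by rwa [hβdef, neg_neg], ⟨SampledPlant.isPreEISS hT₁ hT₂.le (by positivity) hdecay,
    fun E φ u hmax => p.not_isBounded_of_isMaximalSolutionPair hT₁.le hT₁₂ hψ hmax⟩, hdecay,
    SampledPlant.hasL2Gain hT₁.le hT₂.le hχ hδ hγ.le hψ hP₁ hP₂ hβ hρ₂ hM h1 h2⟩
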